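/- Let $\mathcal A_i=\{\rho(\cos\theta,\sin\theta):\rho>0,\ (i-1)\tfrac{\pi}{4}<\theta<i\tfrac{\pi}{4}\}\subset\mathbb R^2$, and let $K^0\in\mathcal A_3$, $K^1\in\mathcal A_4$. Let $h=(h_1,h_2):\mathbb R\to\mathbb R^2$ be continuous with $h'(x)=K^0$ for $x<0$ and $h'(x)=K^1$ for $x>0$. (a) The Hamilton--Jacobi system $$u_1=h_1-u_1'u_2'-\tfrac12(u_1')^2,\qquad u_2=h_2-u_1'u_2'-\tfrac12(u_2')^2$$ has no admissible solution on $\mathbb R$. Here $u=(u_1,u_2)$ is called admissible if: $u$ is absolutely continuous on every compact interval and satisfies the system at a.e. $x\in\mathbb R$; there is a constant $C$ with $|u(x)|\le C(1+|x|)$ for all $x$; at every $y\in\mathbb R$ the derivative $u'$ has a left limit $u'(y-)$ and a right limit $u'(y+)$, and wherever these differ, $u_1'(y+)+u_2'(y+)\le 0$ or $u_1'(y-)+u_2'(y-)\ge 0$. (b) Consider the system obtained for $p=u'$ in the variable $s$ with $ds/dx=(p_1^2+p_1p_2+p_2^2)^{-1}$, $s(0)=0$, namely $$\frac{dp_1}{ds}=(\kappa_1-\kappa_2)p_1+\kappa_1p_2-p_1^2,\qquad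 \frac{dp_2}{ds}=(\kappa_2-\kappa_1)p_2+\kappa_2p_1-p_2^2,$$ with $(\kappa_1,\kappa_2)=K^0$ for $s<0$ and $(\kappa_1,\kappa_2)=K^1$ for $s>0$. Let $p$ be a continuous maximal solution whose domain $I$ is an open interval containing $[0,+\infty[$, and suppose that $p$ is bounded as $s\to+\infty$. Then - either $p(s)\to(0,0)$ as $s\to+\infty$, or $p(s)=K^1$ for all $s\ge 0$; and - backward in $s$, $p$ blows up at a finite value, that is, $I=\,]\sigma,+\infty[$ with $-\infty<\sigma<0$ and $|p(s)|\to+\infty$ as $s\to\sigma+$, except in the cases where $I=\mathbb R$ and either $p(s)\to(0,0)$ as $s\to-\infty$ or $p(s)=K^0$ for all $s\le 0$. -/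

import Mathlib

open Set Filter Topology MeasureTheory

noncomputable section

namespace DiffGame

/-- The open sector `{ρ (cos θ, sin θ) : ρ > 0, (i - 1) π / 4 < θ < i π / 4}` of the plane. -/
def sector (i : ℕ) : Set (ℝ × ℝ) :=
  {q | ∃ ρ θ : ℝ, 0 < ρ ∧ θ ∈ Ioo (((i : ℝ) - 1) * (Real.pi / 4)) ((i : ℝ) * (Real.pi / 4)) ∧
    q = (ρ * Real.cos θ, ρ * Real.sin θ)}

/-- `h = (h₁, h₂)` is a continuous pair of piecewise linear costs whose derivative is the constant
vector `K₀` on `x < 0` and the constant vector `K₁` on `x > 0`. -/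
structure IsOneJumpCost (h : ℝ → ℝ × ℝ) (K₀ K₁ : ℝ × ℝ) : Prop where
  continuous : Continuous h
  left : ∀ x < 0, HasDerivAt h K₀ x
  right : ∀ x > 0, HasDerivAt h K₁ x

/-- At the point `x` the function `u = (u₁, u₂)` is differentiable and solves
`u₁ = h₁ - u₁' u₂' - (u₁')² / 2`, `u₂ = h₂ - u₁' u₂' - (u₂')² / 2`. -/
def SolvesHJAt (h u : ℝ → ℝ × ℝ) (x : ℝ) : Prop :=
  DifferentiableAt ℝ u x ∧
  (u x).1 = (h x).1 - (deriv u x).1 * (deriv u x).2 - (deriv u x).1 ^ 2 / 2 ∧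
  (u x).2 = (h x).2 - (deriv u x).1 * (deriv u x).2 - (deriv u x).2 ^ 2 / 2

/-- `p` is the right limit `u'(y+)` of the (almost everywhere defined) derivative of `u`:
the limit is taken along the points where `u` is differentiable. -/
def HasRightDerivLimit (u : ℝ → ℝ × ℝ) (y : ℝ) (p : ℝ × ℝ) : Prop :=
  Tendsto (deriv u) (𝓝[{x | y < x ∧ DifferentiableAt ℝ u x}] y) (𝓝 p)

/-- `p` is the left limit `u'(y-)` of the (almost everywhere defined) derivative of `u`. -/
def HasLeftDerivLimit (u : ℝ → ℝ × ℝ) (y : ℝ) (p : ℝ × ℝ) : Prop :=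
  Tendsto (deriv u) (𝓝[{x | x < y ∧ DifferentiableAt ℝ u x}] y) (𝓝 p)

/-- Admissible solutions of the Hamilton-Jacobi system with costs `h`. -/
structure IsAdmissible (h u : ℝ → ℝ × ℝ) : Prop where
  /-- `u` is absolutely continuous on every compact interval. -/
  absCont : ∀ a b : ℝ, AbsolutelyContinuousOnInterval u a b
  /-- `u'` satisfies the system almost everywhere. -/
  solves : ∀ᵐ x : ℝ, SolvesHJAt h u x
  /-- At most linear growth. -/
  growth : ∃ C : ℝ, ∀ x : ℝ, ‖u x‖ ≤ C * (1 + |x|)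
  /-- `u'` has one-sided limits `u'(y-) = pl`, `u'(y+) = pr` everywhere, and at a jump
  `u₁'(y+) + u₂'(y+) ≤ 0` or `u₁'(y-) + u₂'(y-) ≥ 0`. -/
  jumps : ∀ y : ℝ, ∃ pl pr : ℝ × ℝ, HasLeftDerivLimit u y pl ∧ HasRightDerivLimit u y pr ∧
    (pl ≠ pr → pr.1 + pr.2 ≤ 0 ∨ 0 ≤ pl.1 + pl.2)

/-- Right-hand side of the rescaled system for `p = u'`, where `K = (h₁', h₂')`. -/
def field (K p : ℝ × ℝ) : ℝ × ℝ :=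
  ((K.1 - K.2) * p.1 + K.1 * p.2 - p.1 ^ 2, (K.2 - K.1) * p.2 + K.2 * p.1 - p.2 ^ 2)

/-- `p` is a continuous solution on `I` of the rescaled system in the variable `s`, whose
coefficients are `K₀` for `s < 0` and `K₁` for `s > 0`. -/
structure IsRescaledSolution (K₀ K₁ : ℝ × ℝ) (I : Set ℝ) (p : ℝ → ℝ × ℝ) : Prop where
  continuousOn : ContinuousOn p I
  left : ∀ s ∈ I, s < 0 → HasDerivAt p (field K₀ (p s)) s
  right : ∀ s ∈ I, 0 < s → HasDerivAt p (field K₁ (p s)) s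

/-- `p` is a maximal solution of the rescaled system, with the open interval `I` as its domain. -/
structure IsMaximalRescaledSolution (K₀ K₁ : ℝ × ℝ) (I : Set ℝ) (p : ℝ → ℝ × ℝ) : Prop where
  isOpen : IsOpen I
  ordConnected : I.OrdConnected
  solution : IsRescaledSolution K₀ K₁ I p
  maximal : ∀ (J : Set ℝ) (q : ℝ → ℝ × ℝ), IsOpen J → J.OrdConnected → I ⊆ J →
    IsRescaledSolution K₀ K₁ J q → EqOn p q I → J = I

end DiffGame

end

open Set Filter Topology MeasureTheory

noncomputable section

namespace DiffGame

/-! ### Scalar differential inequalities -/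

/-! For K in the fourth sector, put S = (p₁ + p₂)/(κ₂ - κ₁), E = (p₂ - p₁)/(κ₂ - κ₁) and rescale
time: the system becomes `planar m` with 0 < m < 1, where K is the rest point (-m, 1), an unstable
focus. A trajectory living for all positive times must avoid S ≤ -2, E ≥ 3/2 and the open third
quadrant, each of which leads to blow-up. If E stays nonpositive, a Riccati inequality for S - E
gives convergence to the origin. Otherwise, unless the trajectory rests at the origin, E becomes and
stays nonnegative, `lyap` increases, and Barbalat's lemma forces convergence to the origin or to the
focus. The focus minimises `lyap` on 0 ≤ E < 3/2, so only the rest trajectory tends to it. This is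
`IsUnstableFocus.tendsto_zero_or_eq`.

The map (a, b) ↦ (-b, -a) with time reversed carries the third sector to the fourth, which settles
negative times when the domain is the whole line. A finite lower endpoint forces blow-up by
continuation (`tendsto_norm_atTop`). This gives (b).

For (a), w = h - u determines p = u' up to sign, so a jump reverses p, and y = (p₁ + p₂)(p₂ - p₁) =
2(w₂ - w₁) is continuous. On the right half-line y(0) < 0 (`IsBranch.prod_neg`). Indeed, if y(0) ≥
0, the branch has no jumps and at most one zero; past that zero, linear growth makes it a rescaled
trajectory defined for all positive times. It is not at rest at K, where y < 0, and it cannot tend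
to 0, because y' = 2(κ₂ - κ₁ - (p₂ - p₁)) would stay above a positive constant while y → 0. The
reflection changes the sign of y, so the left half-line demands y(0) > 0, a contradiction. -/

theorem monotoneOn_Ici_of_hasDerivAt {f f' : ℝ → ℝ} {a : ℝ} (hf : ContinuousOn f (Ici a))
    (hd : ∀ t > a, HasDerivAt f (f' t) t) (h0 : ∀ t > a, 0 ≤ f' t) : MonotoneOn f (Ici a) := by
  apply monotoneOn_of_deriv_nonneg (convex_Ici a) hf
  · rw [interior_Ici]
    exact fun t ht => (hd t ht).differentiableAt.differentiableWithinAt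
  · rw [interior_Ici]
    intro t ht
    rw [(hd t ht).deriv]
    exact h0 t ht

theorem add_mul_le_of_le_deriv {f f' : ℝ → ℝ} {a k : ℝ} (hf : ContinuousOn f (Ici a))
    (hd : ∀ t > a, HasDerivAt f (f' t) t) (hk : ∀ t > a, k ≤ f' t) {t : ℝ} (ht : a ≤ t) :
    f a + k * (t - a) ≤ f t := by
  have := monotoneOn_Ici_of_hasDerivAt (f := fun t => f t - k * t) (f' := fun t => f' t - k)
    (hf.sub (by fun_prop)) (fun t ht => by
      simpa using (hd t ht).fun_sub ((hasDerivAt_id' t).const_mul k))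
    (fun t ht => by linarith [hk t ht]) self_mem_Ici ht ht
  simp only at this
  linarith

/-- A function satisfying `v' ≤ -k v²` which stays negative cannot exist for all times. -/
theorem false_of_riccati {v v' : ℝ → ℝ} {a k : ℝ} (hk : 0 < k) (hv : ContinuousOn v (Ici a))
    (hd : ∀ t > a, HasDerivAt v (v' t) t) (hneg : ∀ t ≥ a, v t < 0)
    (hle : ∀ t > a, v' t ≤ -k * v t ^ 2) : False := by
  -- The derivative of 1/v is -v'/v² ≥ k, so the negative quantity 1/v would reach 0 in finite time.
  have h : ∀ t ≥ a, (v a)⁻¹ + k * (t - a) ≤ (v t)⁻¹ := by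
    intro t ht
    refine add_mul_le_of_le_deriv (f' := fun t => -(v' t) / v t ^ 2)
      (hv.inv₀ fun t ht => (hneg t ht).ne)
      (fun t ht => (hd t ht).fun_inv (hneg t ht.le).ne) ?_ ht
    intro t ht
    have h2 : 0 < v t ^ 2 := sq_pos_of_neg (hneg t ht.le)
    rw [le_div_iff₀ h2]
    linarith [hle t ht]
  -- At this time the linear lower bound for 1/v equals exactly 0.
  have h1 := h (a + -(v a)⁻¹ / k) (by
    have : (v a)⁻¹ < 0 := inv_lt_zero.2 (hneg a le_rfl)
    have : 0 < -(v a)⁻¹ / k := div_pos (by linarith) hk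
    linarith)
  have h2 : (v (a + -(v a)⁻¹ / k))⁻¹ < 0 := inv_lt_zero.2 (hneg _ (by
    have : (v a)⁻¹ < 0 := inv_lt_zero.2 (hneg a le_rfl)
    have : 0 < -(v a)⁻¹ / k := div_pos (by linarith) hk
    linarith))
  have h3 : k * (a + -(v a)⁻¹ / k - a) = -(v a)⁻¹ := by field_simp; ring
  linarith

/-- A positive function satisfying `v' ≤ -v²` tends to `0`. -/
theorem tendsto_zero_of_riccati {v v' : ℝ → ℝ} {a : ℝ}
    (hv : ContinuousOn v (Ici a)) (hd : ∀ t > a, HasDerivAt v (v' t) t) (hpos : ∀ t ≥ a, 0 < v t)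
    (hle : ∀ t > a, v' t ≤ -v t ^ 2) : Tendsto v atTop (𝓝 0) := by
  have h : ∀ t ≥ a, (v a)⁻¹ + 1 * (t - a) ≤ (v t)⁻¹ := by
    intro t ht
    refine add_mul_le_of_le_deriv (f' := fun t => -(v' t) / v t ^ 2)
      (hv.inv₀ fun t ht => (hpos t ht).ne')
      (fun t ht => (hd t ht).fun_inv (hpos t ht.le).ne') ?_ ht
    intro t ht
    have h2 : 0 < v t ^ 2 := by have := hpos t ht.le; positivity
    rw [le_div_iff₀ h2]
    linarith [hle t ht]
  have h1 : Tendsto (fun t => (v t)⁻¹) atTop atTop := by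
    apply tendsto_atTop_mono' _ _ (tendsto_atTop_add_const_right _ (-a) tendsto_id)
    filter_upwards [eventually_ge_atTop a] with t ht
    have := h t ht
    have h3 : 0 < (v a)⁻¹ := inv_pos.2 (hpos a le_rfl)
    simp only [id]
    linarith
  simpa [Function.comp_def] using tendsto_inv_atTop_zero.comp h1

/-- A barrier: if `f' < 0` wherever `f = c`, then `f` stays below `c`. -/
theorem le_of_deriv_neg_of_eq {f f' : ℝ → ℝ} {a b c : ℝ} (hf : ContinuousOn f (Icc a b))
    (hd : ∀ t ∈ Ico a b, HasDerivWithinAt f (f' t) (Ici t) t)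
    (ha : f a ≤ c) (h : ∀ t ∈ Ico a b, f t = c → f' t < 0) : ∀ t ∈ Icc a b, f t ≤ c := by
  intro t ht
  exact image_le_of_deriv_right_lt_deriv_boundary' hf hd (B := fun _ => c) (B' := fun _ => 0)
    ha continuousOn_const (fun _ _ => hasDerivWithinAt_const ..) h ht

/-- The version of the barrier for a lower bound. -/
theorem ge_of_deriv_pos_of_eq {f f' : ℝ → ℝ} {a b c : ℝ} (hf : ContinuousOn f (Icc a b))
    (hd : ∀ t ∈ Ico a b, HasDerivWithinAt f (f' t) (Ici t) t)
    (ha : c ≤ f a) (h : ∀ t ∈ Ico a b, f t = c → 0 < f' t) : ∀ t ∈ Icc a b, c ≤ f t := by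
  intro t ht
  have := le_of_deriv_neg_of_eq (f := fun t => -f t) (f' := fun t => -f' t) (c := -c) hf.neg
    (fun t ht => (hd t ht).neg) (by linarith)
    (fun t ht h1 => by have := h t ht (by linarith); linarith) t ht
  linarith

/-- **Barbalat's lemma** along a Lipschitz curve in a compact set. -/
theorem tendsto_zero_of_tendsto_of_hasDerivAt {E : Type*} [NormedAddCommGroup E]
    {B : Set E} (hB : IsCompact B) {Φ : E → ℝ} (hΦ : ContinuousOn Φ B) {p : ℝ → E} {a : ℝ}
    {L : NNReal} (hL : LipschitzOnWith L p (Ici a)) (hp : ∀ t ≥ a, p t ∈ B) {f : ℝ → ℝ}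
    (hf : ∀ t ≥ a, HasDerivAt f (Φ (p t)) t) {l : ℝ} (hl : Tendsto f atTop (𝓝 l)) :
    Tendsto (fun t => Φ (p t)) atTop (𝓝 0) := by
  have hu : UniformContinuousOn (fun t => Φ (p t)) (Ici a) :=
    (hB.uniformContinuousOn_of_continuous hΦ).comp hL.uniformContinuousOn hp
  rw [Metric.uniformContinuousOn_iff] at hu
  rw [Metric.tendsto_nhds]
  intro ε hε
  obtain ⟨η, hη, h⟩ := hu (ε / 2) (by positivity)
  -- Slopes over a window of fixed length vanish in the limit. The mean value theorem turns each
  -- slope into a value of Φ ∘ p within η of t, and uniform continuity transfers it to t.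
  have h1 : Tendsto (fun t => (f (t + η / 2) - f t) / (η / 2)) atTop (𝓝 0) := by
    have := ((hl.comp (tendsto_atTop_add_const_right _ (η / 2) tendsto_id)).sub hl).div_const
      (η / 2)
    simpa using this
  rw [Metric.tendsto_nhds] at h1
  filter_upwards [h1 (ε / 2) (by positivity), eventually_ge_atTop a] with t ht hta
  obtain ⟨ξ, hξ, he⟩ := exists_hasDerivAt_eq_slope f (fun t => Φ (p t))
    (show t < t + η / 2 by linarith)
    (fun x hx => (hf x (hta.trans hx.1)).continuousAt.continuousWithinAt)
    (fun x hx => hf x (hta.trans hx.1.le))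
  have h2 := h t hta ξ (hta.trans hξ.1.le) (by
    rw [Real.dist_eq, abs_lt]; constructor <;> linarith [hξ.1, hξ.2])
  rw [show t + η / 2 - t = η / 2 by ring] at he
  rw [← he] at ht
  calc dist (Φ (p t)) 0 ≤ dist (Φ (p t)) (Φ (p ξ)) + dist (Φ (p ξ)) 0 := dist_triangle _ _ _
    _ < ε := by linarith

/-- Two solutions of an autonomous equation with `C¹` right-hand side on an open interval which
agree at one point are equal. -/
theorem eqOn_of_hasDerivAt {E : Type*} [NormedAddCommGroup E] [NormedSpace ℝ E] {f : E → E}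
    (hf : ContDiff ℝ 1 f) {I : Set ℝ} (hI : IsOpen I) (hc : I.OrdConnected) {p q : ℝ → E}
    (hp : ∀ t ∈ I, HasDerivAt p (f (p t)) t) (hq : ∀ t ∈ I, HasDerivAt q (f (q t)) t) {t₀ : ℝ}
    (ht₀ : t₀ ∈ I) (h : p t₀ = q t₀) : EqOn p q I := by
  have main : ∀ t ∈ I, p t = q t → p =ᶠ[𝓝 t] q := by
    intro t ht he
    obtain ⟨K, s, hs, hl⟩ := (hf.contDiffAt (x := p t)).exists_lipschitzOnWith
    refine ODE_solution_unique_of_eventually (v := fun _ => f) (s := fun _ => s) (K := K)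
      (Eventually.of_forall fun _ => hl) ?_ ?_ he
    · filter_upwards [hI.mem_nhds ht, (hp t ht).continuousAt hs] with x hx hx'
      exact ⟨hp x hx, hx'⟩
    · filter_upwards [hI.mem_nhds ht, (hq t ht).continuousAt (he ▸ hs)] with x hx hx'
      exact ⟨hq x hx, hx'⟩
  -- The set of local agreement is open and relatively closed in the connected set I.
  have hsub : I ⊆ {t | p =ᶠ[𝓝 t] q} := by
    apply hc.isPreconnected.subset_of_closure_inter_subset isOpen_setOfPred_eventually_nhds
      ⟨t₀, ht₀, main t₀ ht₀ h⟩
    rintro t ⟨htc, htI⟩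
    refine main t htI (tendsto_nhds_unique_of_frequently_eq (hp t htI).continuousAt
      (hq t htI).continuousAt ?_)
    exact (mem_closure_iff_frequently.1 htc).mono fun x hx => hx.self_of_nhds
  exact fun t ht => (hsub ht).self_of_nhds

/-! ### The normalised planar system -/

/-- The planar field `S' = -m S + E - S² - E²`, `E' = 3 S + m E - 2 S E`. -/
def planar (m : ℝ) (q : ℝ × ℝ) : ℝ × ℝ :=
  (-m * q.1 + q.2 - q.1 ^ 2 - q.2 ^ 2, 3 * q.1 + m * q.2 - 2 * q.1 * q.2)

theorem contDiff_planar (m : ℝ) : ContDiff ℝ 1 (planar m) := by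
  unfold planar; fun_prop

/-- The Lyapunov function of the planar system in the strip `E < 3 / 2`. -/
def lyap (m S E : ℝ) : ℝ :=
  (S + m * E / (3 - 2 * E)) ^ 2 / (3 - 2 * E) +
    (-(3 - 2 * E) + 4 * Real.log (3 - 2 * E) + 3 / (3 - 2 * E) +
      3 * m ^ 2 * ((1 - 1 / (3 - 2 * E)) ^ 2 / (3 - 2 * E))) / 4

/-- For c = 1, z = S + mE/(3 - 2E) equals E'/(3 - 2E), so z = 0 is the nullcline of E. The
derivative is a multiple of E z², hence nonnegative when c, m and E are. The factor c allows any
change of speed. -/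
theorem hasDerivAt_lyap {m c t : ℝ} {S E : ℝ → ℝ}
    (hS : HasDerivAt S (c * (-m * S t + E t - S t ^ 2 - E t ^ 2)) t)
    (hE : HasDerivAt E (c * (3 * S t + m * E t - 2 * S t * E t)) t) (hr : E t < 3 / 2) :
    HasDerivAt (fun t => lyap m (S t) (E t))
      (c * (8 * m * E t * (S t + m * E t / (3 - 2 * E t)) ^ 2 / (3 - 2 * E t) ^ 2)) t := by
  have hr0 : 3 - 2 * E t ≠ 0 := by linarith
  have h1 : HasDerivAt (fun t => 3 - 2 * E t)
      (-(2 * (c * (3 * S t + m * E t - 2 * S t * E t)))) t := (hE.const_mul 2).const_sub 3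
  have h2 := hS.fun_add ((hE.const_mul m).fun_div h1 hr0)
  have h3 := (h2.fun_pow 2).fun_div h1 hr0
  have h4 := ((h1.fun_neg.fun_add ((h1.log hr0).const_mul 4)).fun_add
    ((hasDerivAt_const t (3 : ℝ)).fun_div h1 hr0)).fun_add
    ((((((hasDerivAt_const t (1 : ℝ)).fun_div h1 hr0).const_sub 1).fun_pow 2).fun_div h1
      hr0).const_mul (3 * m ^ 2))
  refine (h3.fun_add (h4.div_const 4)).congr_deriv ?_
  -- With E = (3 - r)/2 the only denominators left are powers of the variable r and numerals.
  obtain ⟨r, hr'⟩ : ∃ r, r = 3 - 2 * E t := ⟨_, rfl⟩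
  have hE' : E t = (3 - r) / 2 := by linarith
  rw [← hr'] at hr0
  rw [← hr', hE']
  push_cast
  field_simp
  ring

/-- The derivative (r - 1)(3 - r)/r² changes sign only at r = 1 inside (0, 3). With r = 3 - 2E this
range is the strip 0 ≤ E < 3/2. -/
theorem two_le_profile {r : ℝ} (h0 : 0 < r) (h3 : r ≤ 3) :
    2 ≤ -r + 4 * Real.log r + 3 / r ∧ (-r + 4 * Real.log r + 3 / r = 2 → r = 1) := by
  set f : ℝ → ℝ := fun r => -r + 4 * Real.log r + 3 / r with hf
  have hd : ∀ x > 0, HasDerivAt f ((x - 1) * (3 - x) / x ^ 2) x := by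
    intro x hx
    have := ((hasDerivAt_id' x).fun_neg.fun_add ((Real.hasDerivAt_log hx.ne').const_mul 4)).fun_add
      ((hasDerivAt_const x (3 : ℝ)).fun_div (hasDerivAt_id' x) hx.ne')
    refine this.congr_deriv ?_
    field_simp
    ring
  have h1 : f 1 = 2 := by norm_num [hf]
  rcases lt_trichotomy r 1 with h | h | h
  · have := strictAntiOn_of_deriv_neg (convex_Icc r 1)
      (fun x hx => (hd x (h0.trans_le hx.1)).continuousAt.continuousWithinAt)
      (fun x hx => by
        rw [interior_Icc] at hx
        have hx0 : 0 < x := h0.trans hx.1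
        rw [(hd x hx0).deriv]
        apply div_neg_of_neg_of_pos _ (by positivity)
        nlinarith [hx.1, hx.2])
      (left_mem_Icc.2 h.le) (right_mem_Icc.2 h.le) h
    rw [h1] at this
    exact ⟨this.le, fun h' => absurd h' this.ne'⟩
  · subst h
    exact ⟨h1.ge, fun _ => rfl⟩
  · have := strictMonoOn_of_deriv_pos (convex_Icc 1 r)
      (fun x hx => (hd x (zero_lt_one.trans_le hx.1)).continuousAt.continuousWithinAt)
      (fun x hx => by
        rw [interior_Icc] at hx
        have hx0 : 0 < x := zero_lt_one.trans hx.1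
        rw [(hd x hx0).deriv]
        apply div_pos _ (by positivity)
        exact mul_pos (by linarith [hx.1]) (by linarith [hx.2]))
      (left_mem_Icc.2 h.le) (right_mem_Icc.2 h.le) h
    rw [h1] at this
    exact ⟨this.le, fun h' => absurd h' this.ne'⟩

theorem lyap_focus (m : ℝ) : lyap m (-m) 1 = 1 / 2 := by
  norm_num [lyap]

/-- The profile contributes at least 2/4 and the two other terms are nonnegative, so all are at
their minimum: E = 1, and then the square vanishes only for S = -m. -/
theorem eq_focus_of_lyap_le {m S E : ℝ} (h0 : 0 ≤ E) (hE : E < 3 / 2) (h : lyap m S E ≤ 1 / 2) :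
    S = -m ∧ E = 1 := by
  have hr : 0 < 3 - 2 * E := by linarith
  obtain ⟨h1, h2⟩ := two_le_profile hr (by linarith)
  have h3 : 0 ≤ 3 * m ^ 2 * ((1 - 1 / (3 - 2 * E)) ^ 2 / (3 - 2 * E)) := by positivity
  have h4 : 0 ≤ (S + m * E / (3 - 2 * E)) ^ 2 / (3 - 2 * E) := by positivity
  unfold lyap at h
  have hE1 : E = 1 := by linarith [h2 (by linarith)]
  subst hE1
  norm_num at h4 h h1 h2
  exact ⟨by linarith, rfl⟩

/-- `(S, E)` solves the planar system for all positive times. -/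
structure IsPlanarSol (m : ℝ) (S E : ℝ → ℝ) : Prop where
  hm0 : 0 < m
  hm1 : m < 1
  dS : ∀ t > 0, HasDerivAt S (-m * S t + E t - S t ^ 2 - E t ^ 2) t
  dE : ∀ t > 0, HasDerivAt E (3 * S t + m * E t - 2 * S t * E t) t

theorem continuousOn_Ici_of_deriv {f f' : ℝ → ℝ} (h : ∀ t > 0, HasDerivAt f (f' t) t) {a : ℝ}
    (ha : 0 < a) : ContinuousOn f (Ici a) :=
  fun t ht => (h t (ha.trans_le ht)).continuousAt.continuousWithinAt

theorem le_Ici_of_deriv_neg_of_eq {f f' : ℝ → ℝ} (h : ∀ t > 0, HasDerivAt f (f' t) t) {a c : ℝ}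
    (ha : 0 < a) (hac : f a ≤ c) (hc : ∀ t ≥ a, f t = c → f' t < 0) {t : ℝ} (ht : a ≤ t) :
    f t ≤ c :=
  le_of_deriv_neg_of_eq ((continuousOn_Ici_of_deriv h ha).mono Icc_subset_Ici_self)
    (fun x hx => (h x (ha.trans_le hx.1)).hasDerivWithinAt) hac (fun x hx => hc x hx.1) t
    ⟨ht, le_rfl⟩

theorem ge_Ici_of_deriv_pos_of_eq {f f' : ℝ → ℝ} (h : ∀ t > 0, HasDerivAt f (f' t) t) {a c : ℝ}
    (ha : 0 < a) (hac : c ≤ f a) (hc : ∀ t ≥ a, f t = c → 0 < f' t) {t : ℝ} (ht : a ≤ t) :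
    c ≤ f t :=
  ge_of_deriv_pos_of_eq ((continuousOn_Ici_of_deriv h ha).mono Icc_subset_Ici_self)
    (fun x hx => (h x (ha.trans_le hx.1)).hasDerivWithinAt) hac (fun x hx => hc x hx.1) t
    ⟨ht, le_rfl⟩

/-! ### Confinement of global planar trajectories. -/

namespace IsPlanarSol

variable {m : ℝ} {S E : ℝ → ℝ}

/-- Below -2 the quadratic term wins, since E - E² ≤ 1/4 and m < 1: S' ≤ -S²/4, and S blows up in
finite time. -/
theorem neg_two_lt (h : IsPlanarSol m S E) {t : ℝ} (ht : 0 < t) : -2 < S t := by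
  by_contra! hS
  have hm0 := h.hm0
  have hm1 := h.hm1
  have key : ∀ x > 0, S x ≤ -2 → -m * S x + E x - S x ^ 2 - E x ^ 2 ≤ -(1 / 4) * S x ^ 2 := by
    intro x _ hx
    nlinarith [sq_nonneg (E x - 1 / 2)]
  have h2 : ∀ x ≥ t, S x ≤ -2 := fun x hx =>
    le_Ici_of_deriv_neg_of_eq h.dS ht hS (fun y hy he => by
      have := key y (ht.trans_le hy) he.le
      rw [he] at this ⊢
      linarith) hx
  exact false_of_riccati (by norm_num : (0 : ℝ) < 1 / 4) (continuousOn_Ici_of_deriv h.dS ht)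
    (fun x hx => h.dS x (ht.trans hx)) (fun x hx => by linarith [h2 x hx])
    (fun x hx => key x (ht.trans hx) (h2 x hx.le))

/-- On E = 3/2 the S terms cancel and E' = 3m/2 > 0, so E ≥ 3/2 persists. There S' ≤ -1/2, which
drives S below -2. -/
theorem lt_three_halves (h : IsPlanarSol m S E) {t : ℝ} (ht : 0 < t) : E t < 3 / 2 := by
  by_contra! hE
  have hm0 := h.hm0
  have hm1 := h.hm1
  have h2 : ∀ x ≥ t, 3 / 2 ≤ E x := fun x hx =>
    ge_Ici_of_deriv_pos_of_eq h.dE ht hE (fun y hy he => by rw [he]; linarith) hx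
  have h3 : ∀ x > t, 1 / 2 ≤ -(-m * S x + E x - S x ^ 2 - E x ^ 2) := fun x hx => by
    nlinarith [h2 x hx.le, sq_nonneg (S x + m / 2)]
  have h4 := add_mul_le_of_le_deriv (continuousOn_Ici_of_deriv h.dS ht).neg
    (fun x hx => (h.dS x (ht.trans hx)).neg) h3 (t := t + 2 * (|S t| + 2))
    (by linarith [abs_nonneg (S t)])
  have h5 := h.neg_two_lt (t := t + 2 * (|S t| + 2)) (by linarith [abs_nonneg (S t)])
  simp only [Pi.neg_apply] at h4
  linarith [le_abs_self (S t)]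

/-- The product SE has derivative (1 - E)(3S² + E²), so it grows in the third quadrant and cannot
vanish at an exit. Trapped there, v = S + E satisfies v' ≤ -v² and blows up. -/
theorem not_neg_neg (h : IsPlanarSol m S E) {t : ℝ} (ht : 0 < t) : ¬ (S t < 0 ∧ E t < 0) := by
  rintro ⟨hS, hE⟩
  have hm0 := h.hm0
  have hm1 := h.hm1
  have dy : ∀ x > 0, HasDerivAt (fun x => S x * E x) ((1 - E x) * (3 * S x ^ 2 + E x ^ 2)) x :=
    fun x hx => ((h.dS x hx).fun_mul (h.dE x hx)).congr_deriv (by ring)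
  have hy0 : 0 < S t * E t := mul_pos_of_neg_of_neg hS hE
  have hmono : ∀ b ≥ t, (∀ x ∈ Ioo t b, E x ≤ 1) → S t * E t ≤ S b * E b := by
    intro b hb hx
    have := monotoneOn_of_deriv_nonneg (f := fun x => S x * E x) (convex_Icc t b)
      (fun x hx => (dy x (ht.trans_le hx.1)).continuousAt.continuousWithinAt)
      (fun x hx => (dy x (ht.trans_le (interior_subset hx).1)).differentiableAt.differentiableWithinAt)
      (fun x hx' => by
        rw [interior_Icc] at hx'
        rw [(dy x (ht.trans hx'.1)).deriv]
        have := hx x hx'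
        have : 0 ≤ 1 - E x := by linarith
        positivity)
    exact this (left_mem_Icc.2 hb) (right_mem_Icc.2 hb) hb
  -- At the first time T with E ≥ 0, continuity gives E = 0, contradicting the growth of SE.
  have hEneg : ∀ x ≥ t, E x < 0 := by
    by_contra! hcon
    obtain ⟨b, hb, hEb⟩ := hcon
    have hcont : ContinuousOn E (Icc t b) :=
      (continuousOn_Ici_of_deriv h.dE ht).mono Icc_subset_Ici_self
    have hclosed : IsClosed (Icc t b ∩ E ⁻¹' Ici 0) :=
      hcont.preimage_isClosed_of_isClosed isClosed_Icc isClosed_Ici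
    have hne : (Icc t b ∩ E ⁻¹' Ici 0).Nonempty := ⟨b, ⟨hb, le_rfl⟩, hEb⟩
    have hbdd : BddBelow (Icc t b ∩ E ⁻¹' Ici 0) := ⟨t, fun x hx => hx.1.1⟩
    obtain ⟨⟨h1, h2⟩, h3⟩ := hclosed.csInf_mem hne hbdd
    set T := sInf (Icc t b ∩ E ⁻¹' Ici 0)
    have hlt : ∀ x ∈ Ioo t T, E x < 0 := by
      intro x hx
      by_contra! hx0
      exact absurd (csInf_le hbdd ⟨⟨hx.1.le, hx.2.le.trans h2⟩, hx0⟩) (not_le.2 hx.2)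
    have h4 := hmono T h1 (fun x hx => by linarith [hlt x hx])
    have h3' : 0 ≤ E T := h3
    have htT : t < T := lt_of_le_of_ne h1 (fun he => by rw [← he] at h3'; linarith)
    have h5 : E T ≤ 0 := by
      have : Tendsto E (𝓝[<] T) (𝓝 (E T)) :=
        (h.dE T (ht.trans_le h1)).continuousAt.mono_left nhdsWithin_le_nhds
      refine le_of_tendsto this ?_
      filter_upwards [Ioo_mem_nhdsLT htT] with x hx using (hlt x hx).le
    have : E T = 0 := le_antisymm h5 h3'
    rw [this] at h4
    linarith
  have hSneg : ∀ x ≥ t, S x < 0 := by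
    intro x hx
    have h1 := hmono x hx (fun y hy => by linarith [hEneg y hy.1.le])
    by_contra! h2
    nlinarith [hEneg x hx]
  refine false_of_riccati (v := fun x => S x + E x) one_pos
    ((continuousOn_Ici_of_deriv h.dS ht).add (continuousOn_Ici_of_deriv h.dE ht))
    (fun x hx => (h.dS x (ht.trans hx)).fun_add (h.dE x (ht.trans hx)))
    (fun x hx => by linarith [hSneg x hx, hEneg x hx]) (fun x hx => ?_)
  have := hSneg x hx.le
  have := hEneg x hx.le
  nlinarith

theorem eventually_lt_of_deriv_neg {f : ℝ → ℝ} {f' t : ℝ} (h : HasDerivAt f f' t) (h' : f' < 0) :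
    ∀ᶠ x in 𝓝[>] t, f x < f t := by
  have := h.hasDerivWithinAt (s := Ioi t)
  rw [hasDerivWithinAt_iff_tendsto_slope' self_notMem_Ioi] at this
  filter_upwards [this.eventually_lt_const h', self_mem_nhdsWithin] with x hx hxt
  rw [slope_def_field] at hx
  rw [div_lt_iff₀ (sub_pos.2 hxt)] at hx
  linarith

/-- On the half-axes the field points into the forbidden open quadrant: E' = 3S < 0 where E = 0 > S,
and S' = E - E² < 0 where S = 0 > E. -/
theorem not_nonpos_nonpos (h : IsPlanarSol m S E) {t : ℝ} (ht : 0 < t) (hS : S t ≤ 0)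
    (hE : E t ≤ 0) : S t = 0 ∧ E t = 0 := by
  rcases hS.lt_or_eq with hS | hS <;> rcases hE.lt_or_eq with hE | hE
  · exact absurd ⟨hS, hE⟩ (h.not_neg_neg ht)
  · exfalso
    have h1 := eventually_lt_of_deriv_neg (h.dE t ht) (by rw [hE]; linarith)
    have h2 : ∀ᶠ x in 𝓝[>] t, S x < 0 :=
      ((h.dS t ht).continuousAt.eventually_lt_const hS).filter_mono nhdsWithin_le_nhds
    obtain ⟨x, h1, h2, hx⟩ := (h1.and (h2.and self_mem_nhdsWithin)).exists
    exact h.not_neg_neg (ht.trans hx) ⟨h2, hE ▸ h1⟩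
  · exfalso
    have h1 := eventually_lt_of_deriv_neg (h.dS t ht) (by rw [hS]; nlinarith)
    have h2 : ∀ᶠ x in 𝓝[>] t, E x < 0 :=
      ((h.dE t ht).continuousAt.eventually_lt_const hE).filter_mono nhdsWithin_le_nhds
    obtain ⟨x, h1, h2, hx⟩ := (h1.and (h2.and self_mem_nhdsWithin)).exists
    exact h.not_neg_neg (ht.trans hx) ⟨hS ▸ h1, h2⟩
  · exact ⟨hS, hE⟩

theorem eq_of_eq (h : IsPlanarSol m S E) {c : ℝ × ℝ} (hc : planar m c = 0) {t : ℝ} (ht : 0 < t)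
    (he : (S t, E t) = c) {x : ℝ} (hx : 0 < x) : (S x, E x) = c := by
  refine eqOn_of_hasDerivAt (contDiff_planar m) isOpen_Ioi ordConnected_Ioi
    (p := fun x => (S x, E x)) (q := fun _ => c) (fun x hx => ?_) (fun x hx => ?_)
    (mem_Ioi.2 ht) he (mem_Ioi.2 hx)
  · exact (h.dS x hx).prodMk (h.dE x hx)
  · rw [hc]
    exact hasDerivAt_const ..

end IsPlanarSol

theorem continuousOn_lyap (m : ℝ) :
    ContinuousOn (fun q : ℝ × ℝ => lyap m q.1 q.2) {q | q.2 < 3 / 2} := by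
  have hr : ∀ q ∈ {q : ℝ × ℝ | q.2 < 3 / 2}, 3 - 2 * q.2 ≠ 0 := by
    intro q hq
    have : q.2 < 3 / 2 := hq
    linarith
  unfold lyap
  fun_prop (disch := exact hr)

theorem tendsto_lyap_focus {m : ℝ} {S E : ℝ → ℝ} (hS : Tendsto S atTop (𝓝 (-m)))
    (hE : Tendsto E atTop (𝓝 1)) : Tendsto (fun t => lyap m (S t) (E t)) atTop (𝓝 (1 / 2)) := by
  have hc : ContinuousAt (fun q : ℝ × ℝ => lyap m q.1 q.2) (-m, 1) := by
    refine (continuousOn_lyap m).continuousAt ((isOpen_lt continuous_snd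
      continuous_const).mem_nhds ?_)
    norm_num
  have h := hc.tendsto.comp (hS.prodMk_nhds hE)
  simp only [lyap_focus] at h
  exact h

/-! ### Convergence of global planar trajectories. -/

namespace IsPlanarSol

variable {m : ℝ} {S E : ℝ → ℝ}

theorem tendsto_zero_of_nonpos (h : IsPlanarSol m S E) (hE : ∀ t > 0, E t ≤ 0)
    (hne : ∀ t > 0, ¬ (S t = 0 ∧ E t = 0)) :
    Tendsto S atTop (𝓝 0) ∧ Tendsto E atTop (𝓝 0) := by
  have hm0 := h.hm0
  have hm1 := h.hm1
  have hS : ∀ t > 0, 0 < S t := by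
    intro t ht
    by_contra! h0
    exact hne t ht (h.not_nonpos_nonpos ht h0 (hE t ht))
  -- With v = S - E, v' = -v² - (3 + m)S + (1 - m)E ≤ -v² because E ≤ 0 < S.
  have hv : Tendsto (fun x => S x - E x) atTop (𝓝 0) := by
    refine tendsto_zero_of_riccati (a := 1)
      ((continuousOn_Ici_of_deriv h.dS one_pos).sub (continuousOn_Ici_of_deriv h.dE one_pos))
      (fun x hx => (h.dS x (one_pos.trans hx)).fun_sub (h.dE x (one_pos.trans hx)))
      (fun x hx => by linarith [hS x (one_pos.trans_le hx), hE x (one_pos.trans_le hx)])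
      (fun x hx => ?_)
    have := hS x (one_pos.trans hx)
    have := hE x (one_pos.trans hx)
    nlinarith
  constructor
  · refine squeeze_zero' ?_ ?_ hv
    · filter_upwards [eventually_gt_atTop 0] with t ht using (hS t ht).le
    · filter_upwards [eventually_gt_atTop 0] with t ht
      linarith [hE t ht]
  · have hv' : Tendsto (fun x => -(S x - E x)) atTop (𝓝 0) := by simpa using hv.neg
    refine tendsto_of_tendsto_of_tendsto_of_le_of_le' hv' tendsto_const_nhds ?_ ?_
    · filter_upwards [eventually_gt_atTop 0] with t ht
      linarith [hS t ht]
    · filter_upwards [eventually_gt_atTop 0] with t ht using hE t ht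

/-- A trajectory in the strip `E ≥ 0` stays in a compact box on which `3 - 2 E` is bounded below. -/
theorem exists_box (h : IsPlanarSol m S E) {a : ℝ} (ha : 0 < a) (hE : ∀ t ≥ a, 0 ≤ E t) :
    ∃ C ε : ℝ, 0 < ε ∧ ∀ t ≥ a, (S t, E t) ∈ Icc (-2) C ×ˢ Icc 0 (3 / 2 - ε) := by
  have hm0 := h.hm0
  have hm1 := h.hm1
  set C := max (S a) 1 with hC
  have hSC : ∀ t ≥ a, S t ≤ C := fun t ht =>
    le_Ici_of_deriv_neg_of_eq h.dS ha (le_max_left _ _) (fun x hx he => by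
      have : 1 ≤ C := le_max_right _ _
      rw [he]
      nlinarith [sq_nonneg (E x - 1 / 2)]) ht
  have hC1 : 1 ≤ C := le_max_right _ _
  -- Chosen so that E' = S(3 - 2E) + mE ≥ m/2 whenever E ≥ 3/2 - ε. Entering that layer would raise
  -- E by 2 within time 4/m, past 3/2.
  set ε := m / (8 * (C + 2)) with hε
  have hε0 : 0 < ε := by positivity
  have hε1 : 8 * (C + 2) * ε = m := by rw [hε]; field_simp
  have hε2 : ε ≤ 1 / 24 := by nlinarith
  refine ⟨C, ε, hε0, fun t ht => ⟨⟨(h.neg_two_lt (ha.trans_le ht)).le, hSC t ht⟩, hE t ht, ?_⟩⟩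
  by_contra! hcon
  have hder : ∀ x ≥ a, 3 / 2 - ε ≤ E x → m / 2 ≤ 3 * S x + m * E x - 2 * S x * E x := by
    intro x hx hEx
    have h1 := h.neg_two_lt (ha.trans_le hx)
    have h2 := h.lt_three_halves (ha.trans_le hx)
    have h3 : -(2 * (C + 2) * (2 * ε)) ≤ S x * (3 - 2 * E x) := by nlinarith
    nlinarith
  have hta := ha.trans_le ht
  have hst : ∀ x ≥ t, 3 / 2 - ε ≤ E x := fun x hx =>
    ge_Ici_of_deriv_pos_of_eq h.dE hta hcon.le
      (fun y hy he => by linarith [hder y (ht.trans hy) he.ge]) hx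
  have h4 := add_mul_le_of_le_deriv (continuousOn_Ici_of_deriv h.dE hta)
    (fun x hx => h.dE x (hta.trans hx))
    (fun x hx => hder x (ht.trans hx.le) (hst x hx.le)) (t := t + 4 / m)
    (by have : 0 < 4 / m := by positivity
        linarith)
  have h5 := h.lt_three_halves (t := t + 4 / m) (by positivity)
  have h6 : m / 2 * (t + 4 / m - t) = 2 := by field_simp; ring
  linarith [hE t ht]

/-- Asymptotic information obtained from the Lyapunov function and Barbalat's lemma. -/
theorem tendsto_of_nonneg (h : IsPlanarSol m S E) {a : ℝ} (ha : 0 < a) (hE : ∀ t ≥ a, 0 ≤ E t) :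
    MonotoneOn (fun t => lyap m (S t) (E t)) (Ici a) ∧
    Tendsto (fun t => E t * (S t + m * E t / (3 - 2 * E t)) ^ 2) atTop (𝓝 0) ∧
    Tendsto (fun t => E t ^ 3 * (1 - E t)) atTop (𝓝 0) ∧
    (Tendsto E atTop (𝓝 0) →
      Tendsto (fun t => 3 * S t + m * E t - 2 * S t * E t) atTop (𝓝 0)) := by
  have hm0 := h.hm0
  have hm1 := h.hm1
  obtain ⟨C, ε, hε, hbox⟩ := h.exists_box ha hE
  set B : Set (ℝ × ℝ) := Icc (-2) C ×ˢ Icc 0 (3 / 2 - ε) with hB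
  have hBc : IsCompact B := isCompact_Icc.prod isCompact_Icc
  have hrB : ∀ q ∈ B, 3 - 2 * q.2 ≠ 0 := by
    rintro ⟨x, y⟩ ⟨_, hy⟩
    have := hy.2
    simp only at this ⊢
    linarith
  have hrB2 : ∀ q ∈ B, (3 - 2 * q.2) ^ 2 ≠ 0 := fun q hq => pow_ne_zero 2 (hrB q hq)
  have hr : ∀ t ≥ a, 2 * ε ≤ 3 - 2 * E t := fun t ht => by linarith [(hbox t ht).2.2]
  have hp : ∀ t ≥ a, HasDerivAt (fun t => (S t, E t)) (planar m (S t, E t)) t := fun t ht =>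
    (h.dS t (ha.trans_le ht)).prodMk (h.dE t (ha.trans_le ht))
  obtain ⟨L, hL⟩ : ∃ L : NNReal, LipschitzOnWith L (fun t => (S t, E t)) (Ici a) := by
    obtain ⟨M, hM⟩ := hBc.exists_bound_of_continuousOn (contDiff_planar m).continuous.continuousOn
    refine ⟨M.toNNReal, (convex_Ici a).lipschitzOnWith_of_nnnorm_hasDerivWithin_le
      (fun t ht => (hp t ht).hasDerivWithinAt) (fun t ht => ?_)⟩
    rw [← NNReal.coe_le_coe, coe_nnnorm]
    exact (hM _ (hbox t ht)).trans (Real.le_coe_toNNReal M)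
  have barb := fun {Φ : ℝ × ℝ → ℝ} (hΦ : ContinuousOn Φ B) =>
    @tendsto_zero_of_tendsto_of_hasDerivAt _ _ _ hBc Φ hΦ _ a L hL hbox
  -- the Lyapunov function converges
  have hly : ∀ t ≥ a, HasDerivAt (fun t => lyap m (S t) (E t))
      (8 * m * E t * (S t + m * E t / (3 - 2 * E t)) ^ 2 / (3 - 2 * E t) ^ 2) t := by
    intro t ht
    have := hasDerivAt_lyap (c := 1) (m := m) (t := t) (S := S) (E := E)
      (by simpa using h.dS t (ha.trans_le ht)) (by simpa using h.dE t (ha.trans_le ht))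
      (h.lt_three_halves (ha.trans_le ht))
    simpa using this
  have hmono : MonotoneOn (fun t => lyap m (S t) (E t)) (Ici a) :=
    monotoneOn_Ici_of_hasDerivAt (fun t ht => (hly t ht).continuousAt.continuousWithinAt)
      (fun t ht => hly t ht.le) (fun t ht => by
        have := hE t ht.le
        positivity)
  have hlycont : ContinuousOn (fun q : ℝ × ℝ => lyap m q.1 q.2) B :=
    (continuousOn_lyap m).mono fun q hq => by
      have := hq.2.2
      simp only [mem_ofPred_eq]
      linarith
  obtain ⟨l, hl⟩ : ∃ l, Tendsto (fun t => lyap m (S t) (E t)) atTop (𝓝 l) := by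
    obtain ⟨M, hM⟩ := hBc.exists_bound_of_continuousOn hlycont
    have hm' : Monotone (fun t => lyap m (S (max t a)) (E (max t a))) := fun x y hxy =>
      hmono (mem_Ici.2 (le_max_right x a)) (mem_Ici.2 (le_max_right y a)) (max_le_max_right _ hxy)
    have hbd : BddAbove (range (fun t => lyap m (S (max t a)) (E (max t a)))) := by
      refine ⟨M, ?_⟩
      rintro _ ⟨t, rfl⟩
      exact (le_abs_self _).trans (hM _ (hbox _ (le_max_right _ _)))
    refine ⟨_, (tendsto_atTop_ciSup hm' hbd).congr' ?_⟩
    filter_upwards [eventually_ge_atTop a] with t ht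
    rw [max_eq_left ht]
  have h1 : Tendsto (fun t =>
      8 * m * E t * (S t + m * E t / (3 - 2 * E t)) ^ 2 / (3 - 2 * E t) ^ 2) atTop (𝓝 0) :=
    barb (Φ := fun q => 8 * m * q.2 * (q.1 + m * q.2 / (3 - 2 * q.2)) ^ 2 / (3 - 2 * q.2) ^ 2)
      (by fun_prop (disch := first | exact hrB | exact hrB2))
      hly hl
  set z : ℝ → ℝ := fun t => S t + m * E t / (3 - 2 * E t) with hz
  have hb : ∀ t ≥ a, 0 ≤ E t ∧ E t ≤ 3 / 2 ∧ 0 < 3 - 2 * E t ∧ 3 - 2 * E t ≤ 3 := fun t ht =>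
    ⟨hE t ht, (h.lt_three_halves (ha.trans_le ht)).le, by linarith [hr t ht],
      by linarith [hE t ht]⟩
  have hez : Tendsto (fun t => E t * z t ^ 2) atTop (𝓝 0) := by
    have h2 := h1.const_mul (9 / (8 * m))
    rw [mul_zero] at h2
    refine squeeze_zero' ?_ ?_ h2
    · filter_upwards [eventually_ge_atTop a] with t ht
      have := hE t ht
      positivity
    · filter_upwards [eventually_ge_atTop a] with t ht
      obtain ⟨h3, h4, h5, h6⟩ := hb t ht
      have : 9 / (8 * m) * (8 * m * E t * (S t + m * E t / (3 - 2 * E t)) ^ 2 / (3 - 2 * E t) ^ 2)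
          = (9 / (3 - 2 * E t) ^ 2) * (E t * z t ^ 2) := by
        simp only [hz]
        field_simp
      rw [this]
      refine le_mul_of_one_le_left (by positivity) ?_
      rw [one_le_div (by positivity)]
      nlinarith
  -- (E² z)² = E³ · E z² and E ≤ 3/2, whence the factor 27/8 = (3/2)³.
  have hz0 : Tendsto (fun t => E t ^ 2 * z t) atTop (𝓝 0) := by
    have h2 : Tendsto (fun t => √(27 / 8 * (E t * z t ^ 2))) atTop (𝓝 0) := by
      have := (hez.const_mul (27 / 8)).sqrt
      simpa using this
    refine squeeze_zero_norm' ?_ h2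
    filter_upwards [eventually_ge_atTop a] with t ht
    obtain ⟨h3, h4, h5, h6⟩ := hb t ht
    rw [Real.norm_eq_abs]
    apply Real.abs_le_sqrt
    have : E t ^ 3 ≤ (3 / 2) ^ 3 := pow_le_pow_left₀ h3 h4 3
    have h7 : 0 ≤ E t * z t ^ 2 := by positivity
    nlinarith
  -- The derivative of E² z, to which Barbalat's lemma is applied again. The weight E² makes the
  -- term 2EE'z = 2(3 - 2E) E z² vanish in the limit, which leaves E³(1 - E) times a factor at least
  -- 1.
  set Φ : ℝ × ℝ → ℝ := fun q => 2 * q.2 * ((3 - 2 * q.2) *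
      (q.1 + m * q.2 / (3 - 2 * q.2))) * (q.1 + m * q.2 / (3 - 2 * q.2)) +
      q.2 ^ 2 * (-(q.1 + m * q.2 / (3 - 2 * q.2)) ^ 2 +
        4 * m * q.2 / (3 - 2 * q.2) * (q.1 + m * q.2 / (3 - 2 * q.2)) +
        q.2 * (1 - q.2) * (1 + 3 * m ^ 2 / (3 - 2 * q.2) ^ 2)) with hΦ
  have hΦc : ContinuousOn Φ B := by
    simp only [hΦ]
    fun_prop (disch := first | exact hrB | exact hrB2)
  have hdz : ∀ t ≥ a, HasDerivAt (fun t => E t ^ 2 * z t) (Φ (S t, E t)) t := by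
    intro t ht
    have ht0 := ha.trans_le ht
    have hr0 : 3 - 2 * E t ≠ 0 := by linarith [hr t ht]
    have d1 : HasDerivAt (fun t => 3 - 2 * E t) (-(2 * (3 * S t + m * E t - 2 * S t * E t))) t :=
      ((h.dE t ht0).const_mul 2).const_sub 3
    have d2 := (h.dS t ht0).fun_add (((h.dE t ht0).const_mul m).fun_div d1 hr0)
    refine (((h.dE t ht0).fun_pow 2).fun_mul d2).congr_deriv ?_
    obtain ⟨r, hr'⟩ : ∃ r, r = 3 - 2 * E t := ⟨_, rfl⟩
    have hE' : E t = (3 - r) / 2 := by linarith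
    rw [← hr'] at hr0
    simp only [hΦ]
    rw [← hr', hE']
    push_cast
    field_simp
    ring
  have hΦ0 : Tendsto (fun t => Φ (S t, E t)) atTop (𝓝 0) := barb hΦc hdz hz0
  have hquart : Tendsto (fun t => E t ^ 3 * (1 - E t)) atTop (𝓝 0) := by
    have hbig : Tendsto (fun t => |Φ (S t, E t)| + 6 * (E t * z t ^ 2) + 3 / 2 * (E t * z t ^ 2) +
        (4 * m * (3 / 2) / (2 * ε)) * |E t ^ 2 * z t|) atTop (𝓝 0) := by
      have := ((hΦ0.abs.add (hez.const_mul 6)).add (hez.const_mul (3 / 2))).add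
        (hz0.abs.const_mul (4 * m * (3 / 2) / (2 * ε)))
      simpa using this
    refine squeeze_zero_norm' ?_ hbig
    filter_upwards [eventually_ge_atTop a] with t ht
    obtain ⟨h3, h4, h5, h6⟩ := hb t ht
    have hr2 := hr t ht
    have key : E t ^ 3 * (1 - E t) * (1 + 3 * m ^ 2 / (3 - 2 * E t) ^ 2) = Φ (S t, E t)
        - 2 * (3 - 2 * E t) * (E t * z t ^ 2) + E t * (E t * z t ^ 2)
        - 4 * m * E t / (3 - 2 * E t) * (E t ^ 2 * z t) := by
      simp only [hΦ, hz]
      ring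
    have habs : |E t ^ 3 * (1 - E t)| ≤
        |E t ^ 3 * (1 - E t) * (1 + 3 * m ^ 2 / (3 - 2 * E t) ^ 2)| := by
      rw [abs_mul _ (1 + _)]
      refine le_mul_of_one_le_right (abs_nonneg _) ?_
      rw [le_abs]
      left
      have : 0 ≤ 3 * m ^ 2 / (3 - 2 * E t) ^ 2 := by positivity
      linarith
    rw [Real.norm_eq_abs]
    refine habs.trans ?_
    rw [key]
    have e0 : 0 ≤ E t * z t ^ 2 := by positivity
    have e1 : |2 * (3 - 2 * E t) * (E t * z t ^ 2)| ≤ 6 * (E t * z t ^ 2) := by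
      rw [abs_of_nonneg (by positivity)]
      exact mul_le_mul_of_nonneg_right (by linarith) e0
    have e2 : |E t * (E t * z t ^ 2)| ≤ 3 / 2 * (E t * z t ^ 2) := by
      rw [abs_of_nonneg (by positivity)]
      exact mul_le_mul_of_nonneg_right (by linarith) e0
    have e3 : |4 * m * E t / (3 - 2 * E t) * (E t ^ 2 * z t)| ≤
        (4 * m * (3 / 2) / (2 * ε)) * |E t ^ 2 * z t| := by
      rw [abs_mul, abs_of_nonneg (by positivity : 0 ≤ 4 * m * E t / (3 - 2 * E t))]
      gcongr
    have e4 := abs_add_le (Φ (S t, E t) - 2 * (3 - 2 * E t) * (E t * z t ^ 2))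
      (E t * (E t * z t ^ 2))
    have e5 := abs_sub (Φ (S t, E t)) (2 * (3 - 2 * E t) * (E t * z t ^ 2))
    exact (abs_sub _ _).trans (by linarith)
  exact ⟨hmono, hez, hquart, barb (Φ := fun q => 3 * q.1 + m * q.2 - 2 * q.1 * q.2) (by fun_prop)
    (fun t ht => h.dE t (ha.trans_le ht))⟩

theorem tendsto_zero_or_eq_focus_of_nonneg (h : IsPlanarSol m S E) {a : ℝ} (ha : 0 < a)
    (hE : ∀ t ≥ a, 0 ≤ E t) :
    (Tendsto S atTop (𝓝 0) ∧ Tendsto E atTop (𝓝 0)) ∨ (S a = -m ∧ E a = 1) := by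
  obtain ⟨hmono, hez, hquart, hE'⟩ := h.tendsto_of_nonneg ha hE
  set z : ℝ → ℝ := fun t => S t + m * E t / (3 - 2 * E t) with hz
  -- by connectedness `E` tends to `0` or to `1`
  obtain ⟨T, hT⟩ := eventually_atTop.1 ((eventually_ge_atTop a).and
    (hquart.eventually_lt_const (show (0 : ℝ) < 1 / 16 by norm_num)))
  have haT : a ≤ T := (hT T le_rfl).1
  have hne : ∀ t ≥ T, E t ≠ 1 / 2 := fun t ht he => by
    have := (hT t ht).2
    rw [he] at this
    norm_num at this
  have hcont : ContinuousOn E (Ici T) := continuousOn_Ici_of_deriv h.dE (ha.trans_le haT)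
  rcases lt_or_gt_of_ne (hne T le_rfl) with hlt | hgt
  · left
    have hlt' : ∀ t ≥ T, E t < 1 / 2 := by
      intro t ht
      by_contra! hge
      obtain ⟨x, hx, he⟩ := intermediate_value_Icc ht (hcont.mono Icc_subset_Ici_self) ⟨hlt.le, hge⟩
      exact hne x hx.1 he
    have hE3 : Tendsto (fun t => E t ^ 3) atTop (𝓝 0) := by
      have := hquart.const_mul 2
      rw [mul_zero] at this
      refine squeeze_zero' ?_ ?_ this
      · filter_upwards [eventually_ge_atTop T] with t ht
        have := hE t (haT.trans ht)
        positivity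
      · filter_upwards [eventually_ge_atTop T] with t ht
        have := pow_nonneg (hE t (haT.trans ht)) 3
        nlinarith [hlt' t ht]
    have hE0 : Tendsto E atTop (𝓝 0) := by
      rw [Metric.tendsto_nhds] at hE3 ⊢
      intro η hη
      filter_upwards [hE3 (η ^ 3) (by positivity), eventually_ge_atTop T] with t ht htT
      have h0 := hE t (haT.trans htT)
      rw [Real.dist_eq, sub_zero] at ht ⊢
      rw [abs_of_nonneg h0]
      rw [abs_of_nonneg (by positivity)] at ht
      exact lt_of_pow_lt_pow_left₀ 3 hη.le ht
    refine ⟨?_, hE0⟩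
    have hq : Tendsto (fun t => (3 * S t + m * E t - 2 * S t * E t - m * E t) / (3 - 2 * E t))
        atTop (𝓝 ((0 - m * 0) / (3 - 2 * 0))) :=
      ((hE' hE0).sub (hE0.const_mul m)).div ((hE0.const_mul 2).const_sub 3) (by norm_num)
    have e : (0 - m * 0) / (3 - 2 * 0) = 0 := by simp
    rw [e] at hq
    refine hq.congr' ?_
    filter_upwards [eventually_ge_atTop a] with t ht
    have : 3 - 2 * E t ≠ 0 := by linarith [h.lt_three_halves (ha.trans_le ht)]
    rw [div_eq_iff this]
    ring
  · right
    have hgt' : ∀ t ≥ T, 1 / 2 < E t := by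
      intro t ht
      by_contra! hge
      obtain ⟨x, hx, he⟩ :=
        intermediate_value_Icc' ht (hcont.mono Icc_subset_Ici_self) ⟨hge, hgt.le⟩
      exact hne x hx.1 he
    have hE1 : Tendsto (fun t => E t - 1) atTop (𝓝 0) := by
      have := hquart.abs.const_mul 8
      simp only [abs_zero, mul_zero] at this
      refine squeeze_zero_norm' ?_ this
      filter_upwards [eventually_ge_atTop T] with t ht
      rw [Real.norm_eq_abs, abs_mul, ← abs_neg (E t - 1), neg_sub, ← mul_assoc]
      refine le_mul_of_one_le_left (abs_nonneg _) ?_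
      have h8 : (1 / 2 : ℝ) ^ 3 ≤ E t ^ 3 := pow_le_pow_left₀ (by norm_num) (hgt' t ht).le 3
      rw [abs_of_nonneg (by linarith : (0 : ℝ) ≤ E t ^ 3)]
      linarith
    have hE1' : Tendsto E atTop (𝓝 1) := by simpa using hE1.add_const 1
    have hzz : Tendsto z atTop (𝓝 0) := by
      have h2 : Tendsto (fun t => √(2 * (E t * z t ^ 2))) atTop (𝓝 0) := by
        have := (hez.const_mul 2).sqrt
        simpa using this
      refine squeeze_zero_norm' ?_ h2
      filter_upwards [eventually_ge_atTop T] with t ht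
      rw [Real.norm_eq_abs]
      apply Real.abs_le_sqrt
      nlinarith [hgt' t ht, sq_nonneg (z t)]
    have hSm : Tendsto S atTop (𝓝 (-m)) := by
      have hq : Tendsto (fun t => z t - m * E t / (3 - 2 * E t)) atTop
          (𝓝 (0 - m * 1 / (3 - 2 * 1))) :=
        hzz.sub ((hE1'.const_mul m).div ((hE1'.const_mul 2).const_sub 3) (by norm_num))
      have e : (0 - m * 1 / (3 - 2 * 1)) = -m := by norm_num
      rw [e] at hq
      simpa [hz] using hq
    have hlim := tendsto_lyap_focus hSm hE1'
    -- An increasing function lies below its limit, which here is the minimum of `lyap`.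
    have hle : lyap m (S a) (E a) ≤ 1 / 2 := by
      refine ge_of_tendsto hlim ?_
      filter_upwards [eventually_ge_atTop a] with t ht using hmono self_mem_Ici ht ht
    exact eq_focus_of_lyap_le (hE a le_rfl) (h.lt_three_halves ha) hle

theorem tendsto_zero_or_eq_focus (h : IsPlanarSol m S E) :
    (Tendsto S atTop (𝓝 0) ∧ Tendsto E atTop (𝓝 0)) ∨ ∀ t > 0, S t = -m ∧ E t = 1 := by
  by_cases hzero : ∃ t > 0, S t = 0 ∧ E t = 0
  · obtain ⟨t, ht, hSt, hEt⟩ := hzero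
    have := fun x (hx : 0 < x) => h.eq_of_eq (c := (0, 0)) (by simp [planar]) ht
      (by rw [hSt, hEt]) hx
    left
    constructor
    · refine tendsto_const_nhds.congr' ?_
      filter_upwards [eventually_gt_atTop 0] with x hx using (congrArg Prod.fst (this x hx)).symm
    · refine tendsto_const_nhds.congr' ?_
      filter_upwards [eventually_gt_atTop 0] with x hx using (congrArg Prod.snd (this x hx)).symm
  push Not at hzero
  by_cases hE : ∀ t > 0, E t ≤ 0
  · exact Or.inl (h.tendsto_zero_of_nonpos hE fun t ht h0 => hzero t ht h0.1 h0.2)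
  push Not at hE
  obtain ⟨a, ha, hEa⟩ := hE
  -- At E = 0 one has E' = 3S, and S ≤ 0 there would put the trajectory at the excluded origin.
  have hE' : ∀ t ≥ a, 0 ≤ E t := fun t ht =>
    ge_Ici_of_deriv_pos_of_eq h.dE ha hEa.le (fun x hx he => by
      rw [he]
      have hx0 := ha.trans_le hx
      by_contra! hcon
      have := h.not_nonpos_nonpos hx0 (by linarith) he.le
      exact hzero x hx0 this.1 this.2) ht
  rcases h.tendsto_zero_or_eq_focus_of_nonneg ha hE' with h1 | ⟨h1, h2⟩
  · exact Or.inl h1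
  · right
    intro t ht
    have := h.eq_of_eq (c := (-m, 1)) (by ext <;> simp [planar] <;> ring) ha (by rw [h1, h2]) ht
    exact ⟨congrArg Prod.fst this, congrArg Prod.snd this⟩

end IsPlanarSol

/-! ### Trajectories of the rescaled system -/

/-- The gradient `K` lies in the open sector of angles between `3π/4` and `π`. -/
structure IsUnstableFocus (K : ℝ × ℝ) : Prop where
  fst_neg : K.1 < 0
  snd_pos : 0 < K.2
  add_neg : K.1 + K.2 < 0

/-- The reflection `(a, b) ↦ (-b, -a)` which conjugates the rescaled system to its time reversal. -/
def reflect (q : ℝ × ℝ) : ℝ × ℝ := (-q.2, -q.1)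

theorem reflect_reflect (q : ℝ × ℝ) : reflect (reflect q) = q := by simp [reflect]

theorem continuous_reflect : Continuous reflect := by unfold reflect; fun_prop

theorem field_reflect (K q : ℝ × ℝ) : field (reflect K) (reflect q) = -reflect (field K q) := by
  ext <;> simp [field, reflect] <;> ring

theorem sqrt_two_mul_cos_sub (θ : ℝ) :
    √2 * Real.cos (θ - Real.pi / 4) = Real.cos θ + Real.sin θ := by
  rw [Real.cos_sub, Real.cos_pi_div_four, Real.sin_pi_div_four]
  have : √2 * √2 = 2 := Real.mul_self_sqrt (by norm_num)
  linear_combination (Real.cos θ + Real.sin θ) / 2 * this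

theorem isUnstableFocus_of_mem_sector {K : ℝ × ℝ} (hK : K ∈ sector 4) : IsUnstableFocus K := by
  obtain ⟨ρ, θ, hρ, ⟨h1, h2⟩, rfl⟩ := hK
  norm_num at h1 h2
  have hπ := Real.pi_pos
  refine ⟨mul_neg_of_pos_of_neg hρ (Real.cos_neg_of_pi_div_two_lt_of_lt ?_ ?_),
    mul_pos hρ (Real.sin_pos_of_pos_of_lt_pi ?_ ?_), ?_⟩ <;> try linarith
  simp only
  rw [← mul_add, ← sqrt_two_mul_cos_sub]
  refine mul_neg_of_pos_of_neg hρ (mul_neg_of_pos_of_neg (by positivity)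
    (Real.cos_neg_of_pi_div_two_lt_of_lt ?_ ?_)) <;> linarith

theorem isUnstableFocus_reflect_of_mem_sector {K : ℝ × ℝ} (hK : K ∈ sector 3) :
    IsUnstableFocus (reflect K) := by
  obtain ⟨ρ, θ, hρ, ⟨h1, h2⟩, rfl⟩ := hK
  norm_num at h1 h2
  have hπ := Real.pi_pos
  have hs : 0 < ρ * Real.sin θ := mul_pos hρ (Real.sin_pos_of_pos_of_lt_pi (by linarith)
    (by linarith))
  have hc : ρ * Real.cos θ < 0 :=
    mul_neg_of_pos_of_neg hρ (Real.cos_neg_of_pi_div_two_lt_of_lt (by linarith) (by linarith))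
  have ha : 0 < ρ * (Real.cos θ + Real.sin θ) := by
    rw [← sqrt_two_mul_cos_sub]
    refine mul_pos hρ (mul_pos (by positivity) (Real.cos_pos_of_mem_Ioo ⟨?_, ?_⟩)) <;> linarith
  exact ⟨by simpa [reflect] using hs, by simpa [reflect] using hc, by simp only [reflect]; linarith⟩

theorem hasDerivAt_fst {p : ℝ → ℝ × ℝ} {p' : ℝ × ℝ} {t : ℝ} (h : HasDerivAt p p' t) :
    HasDerivAt (fun t => (p t).1) p'.1 t :=
  (ContinuousLinearMap.fst ℝ ℝ ℝ).hasFDerivAt.comp_hasDerivAt t h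

theorem hasDerivAt_snd {p : ℝ → ℝ × ℝ} {p' : ℝ × ℝ} {t : ℝ} (h : HasDerivAt p p' t) :
    HasDerivAt (fun t => (p t).2) p'.2 t :=
  (ContinuousLinearMap.snd ℝ ℝ ℝ).hasFDerivAt.comp_hasDerivAt t h

namespace IsUnstableFocus

variable {K : ℝ × ℝ}

/-- The parameter of the normalised system. -/
def param (K : ℝ × ℝ) : ℝ := -(K.1 + K.2) / (K.2 - K.1)

theorem sub_pos (hK : IsUnstableFocus K) : 0 < K.2 - K.1 := by
  linarith [hK.fst_neg, hK.snd_pos]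

theorem param_pos (hK : IsUnstableFocus K) : 0 < param K :=
  div_pos (by linarith [hK.add_neg]) hK.sub_pos

theorem param_lt_one (hK : IsUnstableFocus K) : param K < 1 := by
  rw [param, div_lt_one hK.sub_pos]
  linarith [hK.snd_pos]

/-- The speed c serves two times: c = 2/(K₂ - K₁) yields exactly the planar system, and c = 1/`disc
p` is the original variable x. -/
theorem hasDerivAt_sum (hK : IsUnstableFocus K) {p : ℝ → ℝ × ℝ} {t c : ℝ}
    (hp : HasDerivAt p (c • field K (p t)) t) :
    HasDerivAt (fun t => ((p t).1 + (p t).2) / (K.2 - K.1))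
      (c * (K.2 - K.1) / 2 * (-param K * (((p t).1 + (p t).2) / (K.2 - K.1)) +
        ((p t).2 - (p t).1) / (K.2 - K.1) - (((p t).1 + (p t).2) / (K.2 - K.1)) ^ 2 -
        (((p t).2 - (p t).1) / (K.2 - K.1)) ^ 2)) t := by
  have hδ := hK.sub_pos.ne'
  refine (((hasDerivAt_fst hp).fun_add (hasDerivAt_snd hp)).div_const _).congr_deriv ?_
  simp only [field, Prod.smul_mk, smul_eq_mul, param]
  field_simp
  ring

theorem hasDerivAt_diff (hK : IsUnstableFocus K) {p : ℝ → ℝ × ℝ} {t c : ℝ}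
    (hp : HasDerivAt p (c • field K (p t)) t) :
    HasDerivAt (fun t => ((p t).2 - (p t).1) / (K.2 - K.1))
      (c * (K.2 - K.1) / 2 * (3 * (((p t).1 + (p t).2) / (K.2 - K.1)) +
        param K * (((p t).2 - (p t).1) / (K.2 - K.1)) -
        2 * (((p t).1 + (p t).2) / (K.2 - K.1)) * (((p t).2 - (p t).1) / (K.2 - K.1)))) t := by
  have hδ := hK.sub_pos.ne'
  refine (((hasDerivAt_snd hp).fun_sub (hasDerivAt_fst hp)).div_const _).congr_deriv ?_
  simp only [field, Prod.smul_mk, smul_eq_mul, param]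
  field_simp
  ring

/-- A trajectory defined for all positive times tends to the origin or rests at the focus. -/
theorem tendsto_zero_or_eq (hK : IsUnstableFocus K) {p : ℝ → ℝ × ℝ}
    (hp : ∀ s > 0, HasDerivAt p (field K (p s)) s) :
    Tendsto p atTop (𝓝 0) ∨ ∀ s > 0, p s = K := by
  set δ := K.2 - K.1 with hδ
  have hδ0 : 0 < δ := hK.sub_pos
  have hq : ∀ t > 0, HasDerivAt (fun t => p (2 / δ * t)) ((2 / δ) • field K (p (2 / δ * t))) t := by
    intro t ht
    have h1 : HasDerivAt (fun t => 2 / δ * t) (2 / δ) t := by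
      simpa using (hasDerivAt_id' t).const_mul (2 / δ)
    exact (hp _ (by positivity)).scomp t h1
  have h2 : 2 / δ * δ / 2 = 1 := by field_simp
  have hsol : IsPlanarSol (param K) (fun t => ((p (2 / δ * t)).1 + (p (2 / δ * t)).2) / δ)
      (fun t => ((p (2 / δ * t)).2 - (p (2 / δ * t)).1) / δ) :=
    { hm0 := hK.param_pos
      hm1 := hK.param_lt_one
      dS := fun t ht => by
        have := hK.hasDerivAt_sum (hq t ht)
        rwa [← hδ, h2, one_mul] at this
      dE := fun t ht => by
        have := hK.hasDerivAt_diff (hq t ht)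
        rwa [← hδ, h2, one_mul] at this }
  have harg : ∀ s : ℝ, 2 / δ * (δ / 2 * s) = s := fun s => by field_simp
  rcases hsol.tendsto_zero_or_eq_focus with ⟨hS, hE⟩ | h
  · left
    have hlin : Tendsto (fun s => δ / 2 * s) atTop atTop :=
      tendsto_id.const_mul_atTop (by positivity)
    have h1 := hS.comp hlin
    have h3 := hE.comp hlin
    simp only [Function.comp_def, harg] at h1 h3
    have := ((h1.sub h3).const_mul (δ / 2)).prodMk_nhds ((h1.add h3).const_mul (δ / 2))
    simp only [sub_zero, add_zero, mul_zero] at this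
    refine this.congr fun s => ?_
    ext <;> field_simp <;> ring
  · right
    intro s hs
    obtain ⟨h1, h3⟩ := h (δ / 2 * s) (by positivity)
    simp only [harg] at h1 h3
    rw [div_eq_iff hδ0.ne'] at h1 h3
    have h4 : param K * δ = -(K.1 + K.2) := by rw [param, ← hδ]; field_simp
    ext <;> linarith

end IsUnstableFocus

theorem contDiff_field (K : ℝ × ℝ) : ContDiff ℝ 1 (field K) := by
  unfold field; fun_prop

theorem hasDerivAt_reflect {K : ℝ × ℝ} {p : ℝ → ℝ × ℝ} {s : ℝ}
    (h : HasDerivAt p (field K (p (-s))) (-s)) :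
    HasDerivAt (fun s => reflect (p (-s))) (field (reflect K) (reflect (p (-s)))) s := by
  rw [field_reflect]
  have h1 := h.scomp s (hasDerivAt_neg s)
  refine ((hasDerivAt_snd h1).fun_neg.prodMk (hasDerivAt_fst h1).fun_neg).congr_deriv ?_
  ext <;> simp [reflect]

/-- A maximal solution blows up at a finite lower end of its domain. -/
theorem IsMaximalRescaledSolution.tendsto_norm_atTop {K₀ K₁ : ℝ × ℝ} {p : ℝ → ℝ × ℝ} {σ : ℝ}
    (hσ : σ < 0) (h : IsMaximalRescaledSolution K₀ K₁ (Ioi σ) p) :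
    Tendsto (fun s => ‖p s‖) (𝓝[>] σ) atTop := by
  by_contra hcon
  obtain ⟨R, hR⟩ : ∃ R : ℝ, ∃ᶠ s in 𝓝[>] σ, ‖p s‖ ≤ R := by
    rw [tendsto_atTop] at hcon
    push Not at hcon
    obtain ⟨R, hR⟩ := hcon
    exact ⟨R, hR.mono fun s hs => hs.le⟩
  -- Near a cluster point q of p at σ, the flow of `field K₀` exists for a uniform time ε. Started
  -- at s₁ with s₁ - σ < ε, it continues p to the left of σ.
  obtain ⟨q, -, hq⟩ := (isCompact_closedBall (0 : ℝ × ℝ) R).exists_mapClusterPt_of_frequently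
    (f := p) (hR.mono fun s hs => by simpa using hs)
  obtain ⟨r, hr, ε, hε, hflow⟩ := (contDiff_field K₀).contDiffAt
    (x := q).exists_forall_mem_closedBall_exists_eq_forall_mem_Ioo_hasDerivAt 0
  have hfr : ∃ᶠ s in 𝓝[>] σ, p s ∈ Metric.closedBall q r :=
    hq.frequently (Metric.closedBall_mem_nhds q hr)
  have hev : ∀ᶠ s in 𝓝[>] σ, s ∈ Ioo σ (min 0 (σ + ε)) :=
    Ioo_mem_nhdsGT (lt_min hσ (by linarith))
  obtain ⟨s₁, hs₁, hσs, hs₁m⟩ := (hfr.and_eventually hev).exists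
  have hs₁0 : s₁ < 0 := hs₁m.trans_le (min_le_left _ _)
  have hs₁ε : s₁ < σ + ε := hs₁m.trans_le (min_le_right _ _)
  obtain ⟨α, hα0, hα⟩ := hflow _ hs₁
  have hα' : ∀ s ∈ Ioo (s₁ - ε) (s₁ + ε),
      HasDerivAt (fun s => α (s - s₁)) (field K₀ (α (s - s₁))) s := fun s hs =>
    (hα (s - s₁) ⟨by linarith [hs.1], by linarith [hs.2]⟩).comp_sub_const s s₁
  -- The cut at 0 keeps the comparison where p obeys the single field of K₀.
  have heq : EqOn p (fun s => α (s - s₁)) (Ioo σ (min 0 (s₁ + ε))) := by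
    refine eqOn_of_hasDerivAt (contDiff_field K₀) isOpen_Ioo ordConnected_Ioo (fun s hs =>
      h.solution.left s hs.1 (hs.2.trans_le (min_le_left _ _))) (fun s hs => hα' s
      ⟨by linarith [hs.1], hs.2.trans_le (min_le_right _ _)⟩) (t₀ := s₁)
      ⟨hσs, lt_min hs₁0 (by linarith)⟩ (by simp [hα0])
  classical
  set P : ℝ → ℝ × ℝ := fun s => if s ≤ s₁ then α (s - s₁) else p s with hP
  have hPp : EqOn P p (Ioi σ) := by
    intro s hs
    by_cases hss : s ≤ s₁
    · simp only [hP, if_pos hss]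
      exact (heq ⟨hs, hss.trans_lt (lt_min hs₁0 (by linarith))⟩).symm
    · simp only [hP, if_neg hss]
  have hPloc : ∀ s, σ < s → P =ᶠ[𝓝 s] p := fun s hs =>
    hPp.eventuallyEq_of_mem (isOpen_Ioi.mem_nhds hs)
  have hPder : ∀ s ∈ Ioi (s₁ - ε), s < 0 → HasDerivAt P (field K₀ (P s)) s := by
    intro s hs hs0
    by_cases hss : s < s₁
    · have hloc : P =ᶠ[𝓝 s] fun s => α (s - s₁) := by
        filter_upwards [isOpen_Iio.mem_nhds hss] with x hx
        exact if_pos (le_of_lt hx)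
      rw [hloc.self_of_nhds]
      exact (hα' s ⟨hs, by linarith⟩).congr_of_eventuallyEq hloc
    · have hσ' : σ < s := hσs.trans_le (not_lt.1 hss)
      rw [(hPloc s hσ').self_of_nhds]
      exact (h.solution.left s hσ' hs0).congr_of_eventuallyEq (hPloc s hσ')
  have hJ := h.maximal (Ioi (s₁ - ε)) P isOpen_Ioi ordConnected_Ioi
    (Ioi_subset_Ioi (by linarith)) ⟨fun s hs => ?_, hPder, fun s hs hs0 => ?_⟩ hPp.symm
  · have : σ ∈ Ioi σ := hJ ▸ (show σ ∈ Ioi (s₁ - ε) from by simp only [mem_Ioi]; linarith)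
    exact lt_irrefl σ this
  · rcases lt_or_ge s 0 with hs0 | hs0
    · exact (hPder s hs hs0).continuousAt.continuousWithinAt
    · have hσ' : σ < s := hσ.trans_le hs0
      exact ((h.solution.continuousOn.continuousAt (isOpen_Ioi.mem_nhds hσ')).congr
        (hPloc s hσ').symm).continuousWithinAt
  · have hσ' : σ < s := hσ.trans hs0
    rw [(hPloc s hσ').self_of_nhds]
    exact (h.solution.right s hσ' hs0).congr_of_eventuallyEq (hPloc s hσ')

theorem eq_of_continuousWithinAt_of_forall_gt {p : ℝ → ℝ × ℝ} {a : ℝ} {c : ℝ × ℝ}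
    (hc : ContinuousWithinAt p (Ici a) a) (h : ∀ s > a, p s = c) : ∀ s, a ≤ s → p s = c := by
  intro s hs
  rcases hs.lt_or_eq with hs | rfl
  · exact h s hs
  · have h1 : Tendsto p (𝓝[>] a) (𝓝 (p a)) := hc.mono_left (nhdsWithin_mono _ Ioi_subset_Ici_self)
    refine tendsto_nhds_unique h1 (tendsto_const_nhds.congr' ?_)
    filter_upwards [self_mem_nhdsWithin] with x hx using (h x hx).symm

/-- Forward and backward behaviour of the maximal solutions defined for all positive times. -/
theorem IsMaximalRescaledSolution.dichotomy {K₀ K₁ : ℝ × ℝ} (hK₀ : IsUnstableFocus (reflect K₀))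
    (hK₁ : IsUnstableFocus K₁) {I : Set ℝ} {p : ℝ → ℝ × ℝ}
    (h : IsMaximalRescaledSolution K₀ K₁ I p) (hI : Ici 0 ⊆ I) :
    (Tendsto p atTop (𝓝 0) ∨ ∀ s, 0 ≤ s → p s = K₁) ∧
      ((∃ σ < 0, I = Ioi σ ∧ Tendsto (fun s => ‖p s‖) (𝓝[>] σ) atTop) ∨
        (I = univ ∧ (Tendsto p atBot (𝓝 0) ∨ ∀ s, s ≤ 0 → p s = K₀))) := by
  have h0 : (0 : ℝ) ∈ I := hI self_mem_Ici
  have hc0 : ContinuousAt p 0 := h.solution.continuousOn.continuousAt (h.isOpen.mem_nhds h0)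
  constructor
  · rcases hK₁.tendsto_zero_or_eq (p := p) (fun s hs => h.solution.right s (hI (le_of_lt hs)) hs)
      with h1 | h1
    · exact Or.inl h1
    · exact Or.inr (eq_of_continuousWithinAt_of_forall_gt hc0.continuousWithinAt h1)
  by_cases hb : BddBelow I
  · left
    set σ := sInf I with hσ
    have hnot : σ ∉ I := by
      intro hmem
      obtain ⟨l, hl, hlI⟩ := exists_Ioc_subset_of_mem_nhds (h.isOpen.mem_nhds hmem) ⟨σ - 1, by simp⟩
      obtain ⟨x, hx1, hx2⟩ := exists_between hl
      exact absurd (csInf_le hb (hlI ⟨hx1, hx2.le⟩)) (not_le.2 hx2)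
    have hσ0 : σ < 0 := lt_of_le_of_ne (csInf_le hb h0) (fun he => hnot (he ▸ h0))
    have hIeq : I = Ioi σ := by
      ext x
      constructor
      · intro hx
        exact lt_of_le_of_ne (csInf_le hb hx) (fun he => hnot (hσ.trans he ▸ hx))
      · intro hx
        obtain ⟨y, hy, hyx⟩ := exists_lt_of_csInf_lt ⟨0, h0⟩ hx
        rcases le_total x 0 with hx0 | hx0
        · exact h.ordConnected.out hy h0 ⟨hyx.le, hx0⟩
        · exact hI hx0
    refine ⟨σ, hσ0, hIeq, ?_⟩
    rw [hIeq] at h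
    exact h.tendsto_norm_atTop hσ0
  · right
    have hIuniv : I = univ := by
      refine eq_univ_of_forall fun x => ?_
      rw [not_bddBelow_iff] at hb
      obtain ⟨y, hy, hyx⟩ := hb x
      rcases le_total x 0 with hx0 | hx0
      · exact h.ordConnected.out hy h0 ⟨hyx.le, hx0⟩
      · exact hI hx0
    refine ⟨hIuniv, ?_⟩
    rcases hK₀.tendsto_zero_or_eq (p := fun s => reflect (p (-s))) (fun s hs => hasDerivAt_reflect
      (h.solution.left (-s) (hIuniv ▸ mem_univ _) (neg_lt_zero.2 hs))) with h1 | h1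
    · left
      have h2 := ((continuous_reflect.tendsto 0).comp h1).comp tendsto_neg_atBot_atTop
      have e : reflect 0 = 0 := by simp [reflect]
      simpa [Function.comp_def, reflect_reflect, e] using h2
    · right
      intro s hs
      have h2 := eq_of_continuousWithinAt_of_forall_gt (p := fun s => reflect (p (-s))) (a := 0)
        (by
          refine ContinuousAt.continuousWithinAt ?_
          have : ContinuousAt (fun s => p (-s)) 0 :=
            ContinuousAt.comp (by simpa using hc0) continuous_neg.continuousAt
          exact continuous_reflect.continuousAt.comp this) h1 (-s) (by linarith)
      simpa [reflect_reflect] using congrArg reflect h2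

/-! ### One-sided derivatives of admissible solutions -/

/-- The Hamiltonian map `p ↦ (p₁ p₂ + p₁² / 2, p₁ p₂ + p₂² / 2)`. -/
def hamil (p : ℝ × ℝ) : ℝ × ℝ := (p.1 * p.2 + p.1 ^ 2 / 2, p.1 * p.2 + p.2 ^ 2 / 2)

theorem continuous_hamil : Continuous hamil := by unfold hamil; fun_prop

theorem hamil_reflect (p : ℝ × ℝ) : hamil (reflect p) = (hamil p).swap := by
  ext <;> simp [hamil, reflect] <;> ring

/-- The Hamiltonian map is injective up to sign. -/
theorem eq_or_eq_neg_of_hamil_eq {p q : ℝ × ℝ} (h : hamil p = hamil q) : p = q ∨ p = -q := by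
  obtain ⟨p1, p2⟩ := p
  obtain ⟨q1, q2⟩ := q
  simp only [hamil, Prod.mk.injEq] at h
  obtain ⟨h1, h2⟩ := h
  -- In terms of ζ = √3(p₁ + p₂) + i(p₂ - p₁), `hamil` is ζ ↦ ζ² up to a linear change of the
  -- target. Below, √3a + ib and √3c + id are the difference and the sum of two such ζ, with
  -- vanishing product.
  set a := p1 + p2 - (q1 + q2) with ha
  set b := p2 - p1 - (q2 - q1) with hb
  set c := p1 + p2 + (q1 + q2) with hc
  set d := p2 - p1 + (q2 - q1) with hd
  have e1 : a * d + b * c = 0 := by simp only [ha, hb, hc, hd]; linarith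
  have e2 : 3 * (a * c) - b * d = 0 := by simp only [ha, hb, hc, hd]; linarith
  have e3 : (3 * a ^ 2 + b ^ 2) * (3 * c ^ 2 + d ^ 2) = 0 := by
    linear_combination (3 * (a * d + b * c)) * e1 + (3 * (a * c) - b * d) * e2
  rcases mul_eq_zero.1 e3 with e | e
  · left
    have h3 : a = 0 := by nlinarith [sq_nonneg a, sq_nonneg b]
    have h4 : b = 0 := by nlinarith [sq_nonneg a, sq_nonneg b]
    ext <;> simp only <;> linarith
  · right
    have h3 : c = 0 := by nlinarith [sq_nonneg c, sq_nonneg d]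
    have h4 : d = 0 := by nlinarith [sq_nonneg c, sq_nonneg d]
    ext <;> simp only [Prod.neg_mk] <;> linarith

/-- One-sided limits of a function depend continuously on the point, from one side. -/
theorem tendsto_of_limits {E : Type*} [TopologicalSpace E] [RegularSpace E] {f g : ℝ → E}
    {D O : Set ℝ} (hO : IsOpen O) {x : ℝ} {a : E} (hf : Tendsto f (𝓝[D ∩ O] x) (𝓝 a))
    (hg : ∀ y ∈ O, ∃ l ≤ 𝓝[D] y, l.NeBot ∧ Tendsto f l (𝓝 (g y))) :
    Tendsto g (𝓝[O] x) (𝓝 a) := by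
  rw [(closed_nhds_basis a).tendsto_right_iff]
  rintro C ⟨hC, hCc⟩
  have h1 := hf hC
  rw [mem_map, mem_nhdsWithin] at h1
  obtain ⟨V, hV, hxV, hsub⟩ := h1
  filter_upwards [inter_mem_nhdsWithin O (hV.mem_nhds hxV)] with y hy
  obtain ⟨l, hl, hne, hlim⟩ := hg y hy.1
  refine hCc.mem_of_tendsto hlim ?_
  have h2 : V ∩ O ∩ D ∈ 𝓝[D] y :=
    inter_mem (mem_nhdsWithin_of_mem_nhds ((hV.inter hO).mem_nhds ⟨hy.2, hy.1⟩))
      self_mem_nhdsWithin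
  filter_upwards [hl h2] with z hz using hsub ⟨hz.1.1, hz.2, hz.1.2⟩

/-- The one-sided derivative of an absolutely continuous function is the one-sided essential limit
of its derivative. -/
theorem hasDerivWithinAt_of_tendsto_ae {v : ℝ → ℝ}
    (hv : ∀ a b : ℝ, AbsolutelyContinuousOnInterval v a b) {x c : ℝ} {s t : Set ℝ}
    [intervalIntegral.FTCFilter x (𝓝[s] x) (𝓝[t] x)]
    (hlim : Tendsto (deriv v) (𝓝[t] x ⊓ ae volume) (𝓝 c)) : HasDerivWithinAt v c s x := by
  have h1 := intervalIntegral.integral_hasDerivWithinAt_of_tendsto_ae_right (a := x) (b := x)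
    (f := deriv v) (s := s) (t := t) IntervalIntegrable.refl
    (measurable_deriv v).stronglyMeasurable.stronglyMeasurableAtFilter hlim
  have h2 : (fun y => (∫ z in x..y, deriv v z) + v x) = v := by
    funext y
    rw [(hv x y).integral_deriv_eq_sub]
    ring
  have h3 := h1.add_const (v x)
  rwa [h2] at h3

theorem absolutelyContinuousOnInterval_comp_lipschitz {u : ℝ → ℝ × ℝ} {a b : ℝ}
    (hu : AbsolutelyContinuousOnInterval u a b) {φ : ℝ × ℝ → ℝ} (hφ : LipschitzWith 1 φ) :
    AbsolutelyContinuousOnInterval (fun x => φ (u x)) a b := by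
  refine squeeze_zero (fun E => Finset.sum_nonneg fun _ _ => dist_nonneg) (fun E => ?_) hu
  refine Finset.sum_le_sum fun i _ => ?_
  simpa using hφ.dist_le_mul (u (E.2 i).1) (u (E.2 i).2)

/-- A genuine jump has q = -p, so either inequality implies the other. The forward branch uses the
second, the reflected backward branch the first. -/
theorem sum_of_hamil_eq {p q : ℝ × ℝ} (h : hamil p = hamil q) (hne : p ≠ q)
    (hj : q.1 + q.2 ≤ 0 ∨ 0 ≤ p.1 + p.2) : q.1 + q.2 ≤ 0 ∧ 0 ≤ p.1 + p.2 := by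
  rcases eq_or_eq_neg_of_hamil_eq h with rfl | rfl
  · exact absurd rfl hne
  · simp only [Prod.fst_neg, Prod.snd_neg] at *
    rcases hj with hj | hj <;> constructor <;> linarith

/-- The one-sided derivatives of an admissible solution, and their properties. -/
theorem IsAdmissible.exists_oneSided {h u : ℝ → ℝ × ℝ} (hh : Continuous h)
    (hu : IsAdmissible h u) : ∃ pl pr : ℝ → ℝ × ℝ,
    (∀ x, HasDerivWithinAt u (pr x) (Ici x) x) ∧ (∀ x, HasDerivWithinAt u (pl x) (Iic x) x) ∧
    (∀ x, Tendsto pr (𝓝[>] x) (𝓝 (pr x))) ∧ (∀ x, Tendsto pl (𝓝[>] x) (𝓝 (pr x))) ∧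
    (∀ x, Tendsto pr (𝓝[<] x) (𝓝 (pl x))) ∧ (∀ x, Tendsto pl (𝓝[<] x) (𝓝 (pl x))) ∧
    (∀ x, hamil (pr x) = h x - u x) ∧ (∀ x, hamil (pl x) = h x - u x) ∧
    ∀ x, pl x ≠ pr x → (pr x).1 + (pr x).2 ≤ 0 ∧ 0 ≤ (pl x).1 + (pl x).2 := by
  choose pl pr hl hr hj using hu.jumps
  have huc : Continuous u := by
    rw [continuous_iff_continuousAt]
    intro x
    have := (hu.absCont (x - 1) (x + 1)).continuousOn
    rw [uIcc_of_le (by linarith)] at this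
    exact this.continuousAt (Icc_mem_nhds (by linarith) (by linarith))
  set D : Set ℝ := {x | SolvesHJAt h u x} with hD
  have hDae : D ∈ ae (volume : Measure ℝ) := hu.solves
  -- A set of full measure is dense, so the one-sided limits can be taken through points where the
  -- equation holds.
  have hne : ∀ (y : ℝ) (O : Set ℝ), IsOpen O → y ∈ closure O → (𝓝[D ∩ O] y).NeBot := by
    intro y O hO hy
    rw [← mem_closure_iff_nhdsWithin_neBot, inter_comm]
    exact closure_minimal ((Measure.dense_of_ae hDae).open_subset_closure_inter hO)
      isClosed_closure hy
  have hneR : ∀ y, (𝓝[D ∩ Ioi y] y).NeBot := fun y => hne y _ isOpen_Ioi (by simp)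
  have hneL : ∀ y, (𝓝[D ∩ Iio y] y).NeBot := fun y => hne y _ isOpen_Iio (by simp)
  have hr' : ∀ y, Tendsto (deriv u) (𝓝[D ∩ Ioi y] y) (𝓝 (pr y)) := fun y =>
    (hr y).mono_left (nhdsWithin_mono _ fun x hx => ⟨hx.2, hx.1.1⟩)
  have hl' : ∀ y, Tendsto (deriv u) (𝓝[D ∩ Iio y] y) (𝓝 (pl y)) := fun y =>
    (hl y).mono_left (nhdsWithin_mono _ fun x hx => ⟨hx.2, hx.1.1⟩)
  have hlimR : ∀ y, ∃ l ≤ 𝓝[D] y, l.NeBot ∧ Tendsto (deriv u) l (𝓝 (pr y)) := fun y =>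
    ⟨_, nhdsWithin_mono _ inter_subset_left, hneR y, hr' y⟩
  have hlimL : ∀ y, ∃ l ≤ 𝓝[D] y, l.NeBot ∧ Tendsto (deriv u) l (𝓝 (pl y)) := fun y =>
    ⟨_, nhdsWithin_mono _ inter_subset_left, hneL y, hl' y⟩
  have hval : ∀ (y : ℝ) (p : ℝ × ℝ), (∃ l ≤ 𝓝[D] y, l.NeBot ∧ Tendsto (deriv u) l (𝓝 p)) →
      hamil p = h y - u y := by
    rintro y p ⟨l, hle, hne, hlim⟩
    have h1 := (continuous_hamil.tendsto p).comp hlim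
    have h2 : Tendsto (fun x => h x - u x) l (𝓝 (h y - u y)) :=
      ((hh.sub huc).tendsto y).mono_left (hle.trans nhdsWithin_le_nhds)
    refine tendsto_nhds_unique (h1.congr' ?_) h2
    filter_upwards [hle self_mem_nhdsWithin] with x hx
    obtain ⟨-, hx1, hx2⟩ := hx
    simp only [Function.comp_apply, hamil]
    ext <;> simp only [Prod.fst_sub, Prod.snd_sub] <;> linarith
  have hder : ∀ (x : ℝ) (c : ℝ × ℝ) (s t : Set ℝ)
      [intervalIntegral.FTCFilter x (𝓝[s] x) (𝓝[t] x)],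
      Tendsto (deriv u) (𝓝[t] x ⊓ ae volume) (𝓝 c) → HasDerivWithinAt u c s x := by
    intro x c s t _ hlim
    have hdiff : ∀ᶠ x in 𝓝[t] x ⊓ ae volume, DifferentiableAt ℝ u x :=
      mem_inf_of_right (mem_of_superset hDae fun x hx => hx.1)
    have h1 : HasDerivWithinAt (fun x => (u x).1) c.1 s x := by
      refine hasDerivWithinAt_of_tendsto_ae (t := t) (fun a b =>
        absolutelyContinuousOnInterval_comp_lipschitz (hu.absCont a b) LipschitzWith.prod_fst) ?_
      refine ((continuous_fst.tendsto c).comp hlim).congr' ?_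
      filter_upwards [hdiff] with x hx using (hasDerivAt_fst hx.hasDerivAt).deriv.symm
    have h2 : HasDerivWithinAt (fun x => (u x).2) c.2 s x := by
      refine hasDerivWithinAt_of_tendsto_ae (t := t) (fun a b =>
        absolutelyContinuousOnInterval_comp_lipschitz (hu.absCont a b) LipschitzWith.prod_snd) ?_
      refine ((continuous_snd.tendsto c).comp hlim).congr' ?_
      filter_upwards [hdiff] with x hx using (hasDerivAt_snd hx.hasDerivAt).deriv.symm
    exact h1.prodMk h2
  refine ⟨pl, pr, fun x => ?_, fun x => ?_, fun x => ?_, fun x => ?_, fun x => ?_, fun x => ?_,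
    fun x => hval x _ (hlimR x), fun x => hval x _ (hlimL x), fun x hne => ?_⟩
  · refine hder x _ (Ici x) (Ioi x) ((hr' x).mono_left ?_)
    exact le_inf (inf_le_left.trans nhdsWithin_le_nhds) (le_principal_iff.2
      (inter_mem (mem_inf_of_right hDae) (mem_inf_of_left self_mem_nhdsWithin)))
  · refine hder x _ (Iic x) (Iic x) ((hl' x).mono_left ?_)
    refine le_inf (inf_le_left.trans nhdsWithin_le_nhds) (le_principal_iff.2
      (inter_mem (mem_inf_of_right hDae) ?_))
    -- The left-hand filter for the fundamental theorem contains x itself, which is discarded as a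
    -- null set.
    have h1 : {x}ᶜ ∈ ae (volume : Measure ℝ) := compl_mem_ae_iff.2 (by simp)
    filter_upwards [mem_inf_of_right h1, mem_inf_of_left self_mem_nhdsWithin] with y hy hy'
    exact lt_of_le_of_ne hy' hy
  · exact tendsto_of_limits isOpen_Ioi (hr' x) fun y _ => hlimR y
  · exact tendsto_of_limits isOpen_Ioi (hr' x) fun y _ => hlimL y
  · exact tendsto_of_limits isOpen_Iio (hl' x) fun y _ => hlimR y
  · exact tendsto_of_limits isOpen_Iio (hl' x) fun y _ => hlimL y
  · exact sum_of_hamil_eq ((hval x _ (hlimL x)).trans (hval x _ (hlimR x)).symm) hne (hj x hne)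

/-! ### Inverting the Hamiltonian map and changing time -/

/-- The determinant of the derivative of the Hamiltonian map. -/
def disc (p : ℝ × ℝ) : ℝ := p.1 ^ 2 + p.1 * p.2 + p.2 ^ 2

theorem continuous_disc : Continuous disc := by unfold disc; fun_prop

theorem disc_pos {p : ℝ × ℝ} (h : p ≠ 0) : 0 < disc p := by
  unfold disc
  by_contra! hle
  apply h
  have h1 : p.1 = 0 := by nlinarith [sq_nonneg (p.1 + 2 * p.2), sq_nonneg p.1]
  have h2 : p.2 = 0 := by nlinarith [sq_nonneg (2 * p.1 + p.2), sq_nonneg p.2]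
  ext <;> simp [h1, h2]

/-- `disc`² = (w₁ + w₂)² + 3(w₁ - w₂)² for w = `hamil p`, that is |ζ²| = |ζ|² in the complex
picture. It turns linear growth of w into linear growth of dx/ds. -/
theorem disc_le_norm_hamil (p : ℝ × ℝ) : disc p ≤ 4 * ‖hamil p‖ := by
  have h1 : |(hamil p).1| ≤ ‖hamil p‖ := norm_fst_le (hamil p)
  have h2 : |(hamil p).2| ≤ ‖hamil p‖ := norm_snd_le (hamil p)
  set M := ‖hamil p‖
  rw [abs_le] at h1 h2
  simp only [hamil] at h1 h2
  have hM : 0 ≤ M := norm_nonneg _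
  unfold disc
  refine abs_le_of_sq_le_sq' (b := 4 * M) ?_ (by positivity) |>.2
  have e : (p.1 ^ 2 + p.1 * p.2 + p.2 ^ 2) ^ 2 =
      ((p.1 * p.2 + p.1 ^ 2 / 2) + (p.1 * p.2 + p.2 ^ 2 / 2)) ^ 2 +
        3 * ((p.1 * p.2 + p.1 ^ 2 / 2) - (p.1 * p.2 + p.2 ^ 2 / 2)) ^ 2 := by ring
  rw [e]
  have h3 : ((p.1 * p.2 + p.1 ^ 2 / 2) + (p.1 * p.2 + p.2 ^ 2 / 2)) ^ 2 ≤ (2 * M) ^ 2 :=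
    sq_le_sq' (by linarith) (by linarith)
  have h4 : ((p.1 * p.2 + p.1 ^ 2 / 2) - (p.1 * p.2 + p.2 ^ 2 / 2)) ^ 2 ≤ (2 * M) ^ 2 :=
    sq_le_sq' (by linarith) (by linarith)
  linarith

/-- A continuous lift of a differentiable curve through the Hamiltonian map is differentiable away
from the origin. -/
theorem hasDerivAt_of_hamil {K : ℝ × ℝ} {p w : ℝ → ℝ × ℝ} {x : ℝ} (hc : ContinuousAt p x)
    (hw : HasDerivAt w (K - p x) x) (he : ∀ᶠ z in 𝓝 x, hamil (p z) = w z) (h0 : p x ≠ 0) :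
    HasDerivAt p ((disc (p x))⁻¹ • field K (p x)) x := by
  rw [hasDerivAt_iff_tendsto_slope] at hw ⊢
  have hc' : Tendsto p (𝓝[≠] x) (𝓝 (p x)) := hc.tendsto.mono_left nhdsWithin_le_nhds
  -- `hamil` is quadratic, so its increment is exactly its derivative at the midpoint applied to the
  -- increment of p. F inverts that derivative, whose determinant is `disc`.
  set μ : ℝ → ℝ × ℝ := fun z => (2 : ℝ)⁻¹ • (p x + p z) with hμ
  have hμt : Tendsto μ (𝓝[≠] x) (𝓝 (p x)) := by
    have h1 : Tendsto μ (𝓝[≠] x) (𝓝 ((2 : ℝ)⁻¹ • (p x + p x))) :=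
      (tendsto_const_nhds.add hc').const_smul _
    have h2 : (2 : ℝ)⁻¹ • (p x + p x) = p x := by
      rw [← two_smul ℝ (p x), smul_smul]; norm_num
    rwa [h2] at h1
  set F : (ℝ × ℝ) × (ℝ × ℝ) → ℝ × ℝ := fun q => (disc q.1)⁻¹ •
    ((q.1.1 + q.1.2) * q.2.1 - q.1.1 * q.2.2, -q.1.2 * q.2.1 + (q.1.1 + q.1.2) * q.2.2) with hF
  have hFc : ContinuousAt F (p x, K - p x) := by
    have h1 : ContinuousAt (fun q : (ℝ × ℝ) × (ℝ × ℝ) => (disc q.1)⁻¹) (p x, K - p x) :=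
      (continuous_disc.comp continuous_fst).continuousAt.inv₀ (disc_pos h0).ne'
    exact h1.smul (by fun_prop)
  have hlim := hFc.tendsto.comp (hμt.prodMk_nhds hw)
  have hval : F (p x, K - p x) = (disc (p x))⁻¹ • field K (p x) := by
    simp only [hF, field]
    congr 1
    ext <;> simp <;> ring
  rw [hval] at hlim
  refine hlim.congr' ?_
  have hpos : ∀ᶠ z in 𝓝[≠] x, μ z ≠ 0 := hμt.eventually_ne h0
  filter_upwards [hpos, he.filter_mono nhdsWithin_le_nhds] with z hz hez
  have hd := (disc_pos hz).ne'
  have hex : hamil (p x) = w x := he.self_of_nhds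
  simp only [Function.comp_apply, hF, slope, vsub_eq_sub, ← hez, ← hex]
  have key : ∀ c : ℝ, disc (μ z) * (c * ((p z).1 - (p x).1)) =
      ((μ z).1 + (μ z).2) * (c * ((hamil (p z)).1 - (hamil (p x)).1)) -
        (μ z).1 * (c * ((hamil (p z)).2 - (hamil (p x)).2)) ∧
      disc (μ z) * (c * ((p z).2 - (p x).2)) =
      -(μ z).2 * (c * ((hamil (p z)).1 - (hamil (p x)).1)) +
        ((μ z).1 + (μ z).2) * (c * ((hamil (p z)).2 - (hamil (p x)).2)) := by
    intro c
    simp only [hμ, disc, hamil, Prod.smul_fst, Prod.smul_snd, Prod.fst_add, Prod.snd_add,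
      smul_eq_mul]
    constructor <;> ring
  obtain ⟨k1, k2⟩ := key (z - x)⁻¹
  ext
  · simp only [Prod.smul_fst, Prod.smul_snd, Prod.fst_sub, Prod.snd_sub, smul_eq_mul]
    rw [← k1]
    field_simp
  · simp only [Prod.smul_fst, Prod.smul_snd, Prod.fst_sub, Prod.snd_sub, smul_eq_mul]
    rw [← k2]
    field_simp

/-- Trajectories in the original variable which avoid the origin and have linearly bounded
discriminant are reparametrised to trajectories of the rescaled system. -/
theorem IsUnstableFocus.tendsto_zero_or_eq_of_disc {K : ℝ × ℝ} (hK : IsUnstableFocus K)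
    {p : ℝ → ℝ × ℝ} {a C : ℝ} (ha : 0 ≤ a) (hp : ContinuousOn p (Ici a)) (hne : ∀ x ≥ a, p x ≠ 0)
    (hd : ∀ x > a, HasDerivAt p ((disc (p x))⁻¹ • field K (p x)) x)
    (hC : ∀ x ≥ a, disc (p x) ≤ C * (1 + x)) :
    Tendsto p atTop (𝓝 0) ∨ ∀ x > a, p x = K := by
  -- Freezing the density to the left of a makes the new time τ a bijection of the whole line.
  set φ : ℝ → ℝ := fun x => (disc (p (max x a)))⁻¹ with hφ
  have hφpos : ∀ x, 0 < φ x := fun x => inv_pos.2 (disc_pos (hne _ (le_max_right _ _)))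
  have hφc : Continuous φ := by
    have h1 : Continuous fun x => p (max x a) := by
      refine hp.comp_continuous (by fun_prop) fun x => ?_
      exact mem_Ici.2 (le_max_right x a)
    exact (continuous_disc.comp h1).inv₀ fun x => (disc_pos (hne _ (le_max_right _ _))).ne'
  set τ : ℝ → ℝ := fun x => ∫ z in a..x, φ z with hτ
  have hτd : ∀ x, HasDerivAt τ (φ x) x := fun x =>
    intervalIntegral.integral_hasDerivAt_right (hφc.intervalIntegrable _ _)
      hφc.stronglyMeasurable.stronglyMeasurableAtFilter hφc.continuousAt
  have hτa : τ a = 0 := intervalIntegral.integral_same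
  have hτm : StrictMono τ := strictMono_of_deriv_pos fun x => by
    rw [(hτd x).deriv]; exact hφpos x
  have hCpos : 0 < C := by
    have h1 := (disc_pos (hne a le_rfl)).trans_le (hC a le_rfl)
    exact pos_of_mul_pos_left h1 (by linarith)
  have hτtop : Tendsto τ atTop atTop := by
    -- The new time is infinite because ∫ dx/(C(1 + x)) diverges logarithmically.
    have h1 : ∀ x ≥ a, C⁻¹ * Real.log (1 + x) + (τ a - C⁻¹ * Real.log (1 + a)) ≤ τ x := by
      intro x hx
      have h2 : ∀ x ≥ a, HasDerivAt (fun x => τ x - C⁻¹ * Real.log (1 + x))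
          (φ x - C⁻¹ * (1 / (1 + x))) x := fun x hx =>
        (hτd x).fun_sub ((((hasDerivAt_id' x).const_add 1).log (by linarith)).const_mul _)
      have h3 := monotoneOn_Ici_of_hasDerivAt
        (fun x hx => (h2 x hx).continuousAt.continuousWithinAt) (fun x hx => h2 x (le_of_lt hx))
        (fun x hx => by
          have hx0 : 0 < 1 + x := by linarith [hx.lt]
          rw [sub_nonneg, one_div, ← mul_inv]
          simp only [hφ, max_eq_left (le_of_lt hx)]
          exact inv_anti₀ (disc_pos (hne x (le_of_lt hx))) (hC x (le_of_lt hx)))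
        self_mem_Ici hx hx
      simp only at h3
      linarith
    have h2 : Tendsto (fun x => C⁻¹ * Real.log (1 + x) + (τ a - C⁻¹ * Real.log (1 + a)))
        atTop atTop :=
      tendsto_atTop_add_const_right _ _ ((Real.tendsto_log_atTop.comp
        (tendsto_atTop_add_const_left _ 1 tendsto_id)).const_mul_atTop (inv_pos.2 hCpos))
    refine tendsto_atTop_mono' _ ?_ h2
    filter_upwards [eventually_ge_atTop a] with x hx using h1 x hx
  have hτbot : Tendsto τ atBot atBot := by
    have h2 : Tendsto (fun x => φ a * (x - a)) atBot atBot :=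
      (tendsto_atBot_add_const_right _ (-a) tendsto_id).const_mul_atBot (hφpos a)
    refine h2.congr' ?_
    filter_upwards [eventually_le_atBot a] with x hx
    have h3 : ∫ z in a..x, φ z = ∫ _ in a..x, φ a := by
      refine intervalIntegral.integral_congr fun z hz => ?_
      rw [uIcc_of_ge hx] at hz
      simp only [hφ, max_eq_right hz.2, max_self]
    simp only [hτ]
    rw [h3, intervalIntegral.integral_const, smul_eq_mul, mul_comm]
  have hτc : Continuous τ := continuous_iff_continuousAt.2 fun x => (hτd x).continuousAt
  set X := (hτm.orderIsoOfSurjective τ (hτc.surjective hτtop hτbot)).symm with hX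
  have hτX : ∀ t, τ (X t) = t := fun t =>
    (hτm.orderIsoOfSurjective τ (hτc.surjective hτtop hτbot)).apply_symm_apply t
  have hXτ : ∀ x, X (τ x) = x := fun x =>
    (hτm.orderIsoOfSurjective τ (hτc.surjective hτtop hτbot)).symm_apply_apply x
  have hXd : ∀ t, HasDerivAt X (φ (X t))⁻¹ t := fun t =>
    HasDerivAt.of_local_left_inverse X.continuous.continuousAt (hτd (X t)) (hφpos _).ne'
      (Eventually.of_forall hτX)
  have hXa : ∀ t > 0, a < X t := fun t ht => by
    rw [← hτm.lt_iff_lt, hτa, hτX]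
    exact ht
  have hq : ∀ t > 0, HasDerivAt (fun t => p (X t)) (field K (p (X t))) t := by
    intro t ht
    refine ((hd _ (hXa t ht)).scomp t (hXd t)).congr_deriv ?_
    have h1 := (disc_pos (hne _ (hXa t ht).le)).ne'
    simp only [hφ, max_eq_left (hXa t ht).le, inv_inv]
    rw [smul_smul, mul_inv_cancel₀ h1, one_smul]
  rcases hK.tendsto_zero_or_eq hq with h | h
  · left
    have := h.comp hτtop
    simpa only [Function.comp_def, hXτ] using this
  · right
    intro x hx
    have := h (τ x) (by rw [← hτa]; exact hτm hx)
    rwa [hXτ] at this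

/-! ### Forward branches with jumps -/

/-- The Hamiltonian values `w` of an admissible solution on `[0, ∞)` with cost gradient `K`, together
with the one-sided limits `pl`, `pr` of the gradient of the solution. -/
structure IsBranch (K : ℝ × ℝ) (w pl pr : ℝ → ℝ × ℝ) : Prop where
  cont : ContinuousOn w (Ici 0)
  derivRight : ∀ x ≥ 0, HasDerivWithinAt w (K - pr x) (Ici x) x
  derivLeft : ∀ x > 0, HasDerivWithinAt w (K - pl x) (Iic x) x
  right : ∀ x ≥ 0, Tendsto pr (𝓝[>] x) (𝓝 (pr x))
  left : ∀ x > 0, Tendsto pr (𝓝[<] x) (𝓝 (pl x))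
  value : ∀ x ≥ 0, hamil (pr x) = w x
  valueLeft : ∀ x > 0, hamil (pl x) = w x
  jump : ∀ x > 0, pl x ≠ pr x → 0 ≤ (pl x).1 + (pl x).2
  growth : ∃ C : ℝ, ∀ x ≥ 0, ‖w x‖ ≤ C * (1 + x)

/-- Induction along a half-line. -/
theorem forall_ge_of_induction {P : ℝ → Prop} {a : ℝ} (h0 : P a)
    (hr : ∀ x ≥ a, P x → ∀ᶠ z in 𝓝[>] x, P z)
    (hl : ∀ x > a, (∀ z ∈ Ico a x, P z) → P x) : ∀ x ≥ a, P x := by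
  by_contra! hcon
  obtain ⟨b, hb, hPb⟩ := hcon
  have hbdd : BddBelow {x | a ≤ x ∧ ¬ P x} := ⟨a, fun x hx => hx.1⟩
  have hne : {x | a ≤ x ∧ ¬ P x}.Nonempty := ⟨b, hb, hPb⟩
  set T := sInf {x | a ≤ x ∧ ¬ P x} with hT
  have haT : a ≤ T := le_csInf hne fun x hx => hx.1
  have hlt : ∀ z ∈ Ico a T, P z := by
    intro z hz
    by_contra hPz
    exact absurd (csInf_le hbdd ⟨hz.1, hPz⟩) (not_le.2 hz.2)
  have hPT : P T := by
    rcases haT.lt_or_eq with h | h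
    · exact hl T h hlt
    · exact h ▸ h0
  obtain ⟨d, hd, hsub⟩ := mem_nhdsGT_iff_exists_Ioo_subset.1 (hr T haT hPT)
  have : d ≤ T := le_csInf hne fun x hx => by
    by_contra! hxd
    have hTx : T ≤ x := csInf_le hbdd hx
    rcases hTx.lt_or_eq with h | h
    · exact hx.2 (hsub ⟨h, hxd⟩)
    · exact hx.2 (h ▸ hPT)
  exact absurd this (not_le.2 hd)

namespace IsBranch

variable {K : ℝ × ℝ} {w pl pr : ℝ → ℝ × ℝ}

theorem two_mul_sub_hamil (p : ℝ × ℝ) :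
    2 * ((hamil p).2 - (hamil p).1) = (p.1 + p.2) * (p.2 - p.1) := by
  simp only [hamil]; ring

theorem prod_eq (h : IsBranch K w pl pr) {x : ℝ} (hx : 0 ≤ x) :
    2 * ((w x).2 - (w x).1) = ((pr x).1 + (pr x).2) * ((pr x).2 - (pr x).1) := by
  rw [← h.value x hx, two_mul_sub_hamil]

theorem prod_eq_left (h : IsBranch K w pl pr) {x : ℝ} (hx : 0 < x) :
    2 * ((w x).2 - (w x).1) = ((pl x).1 + (pl x).2) * ((pl x).2 - (pl x).1) := by
  rw [← h.valueLeft x hx, two_mul_sub_hamil]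

theorem eq_or_eq_neg (h : IsBranch K w pl pr) {x : ℝ} (hx : 0 < x) :
    pl x = pr x ∨ (pr x = -pl x ∧ 0 ≤ (pl x).1 + (pl x).2) := by
  by_cases he : pl x = pr x
  · exact Or.inl he
  · rcases eq_or_eq_neg_of_hamil_eq ((h.value x hx.le).trans (h.valueLeft x hx).symm) with h1 | h1
    · exact absurd h1.symm he
    · exact Or.inr ⟨h1, h.jump x hx he⟩

/-- From w' = K - p, the product y = 2(w₂ - w₁) has right derivative 2(K₂ - K₁ - (p₂ - p₁)). Working
with w makes the estimate valid across jumps. -/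
theorem le_prod (h : IsBranch K w pl pr) {a b c : ℝ} (ha : 0 ≤ a) (hab : a ≤ b)
    (hc : ∀ x ∈ Ico a b, (pr x).2 - (pr x).1 ≤ c) :
    2 * ((w a).2 - (w a).1) + 2 * (K.2 - K.1 - c) * (b - a) ≤ 2 * ((w b).2 - (w b).1) := by
  have hcont : ContinuousOn (fun x => 2 * ((w x).2 - (w x).1)) (Icc a b) := by
    have : ContinuousOn w (Icc a b) :=
      h.cont.mono (Icc_subset_Ici_self.trans (Ici_subset_Ici.2 ha))
    fun_prop
  have hder : ∀ x ∈ Ico a b, HasDerivWithinAt (fun x => -(2 * ((w x).2 - (w x).1)))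
      (-(2 * ((K.2 - (pr x).2) - (K.1 - (pr x).1)))) (Ici x) x := by
    intro x hx
    have h1 := h.derivRight x (ha.trans hx.1)
    have h2 : HasDerivWithinAt (fun x => (w x).1) (K - pr x).1 (Ici x) x :=
      (ContinuousLinearMap.fst ℝ ℝ ℝ).hasFDerivAt.comp_hasDerivWithinAt x h1
    have h3 : HasDerivWithinAt (fun x => (w x).2) (K - pr x).2 (Ici x) x :=
      (ContinuousLinearMap.snd ℝ ℝ ℝ).hasFDerivAt.comp_hasDerivWithinAt x h1
    exact ((h3.fun_sub h2).const_mul 2).fun_neg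
  have := image_le_of_deriv_right_le_deriv_boundary hcont.neg hder
    (B := fun x => -(2 * ((w a).2 - (w a).1)) - 2 * (K.2 - K.1 - c) * (x - a))
    (B' := fun _ => -(2 * (K.2 - K.1 - c))) (by simp) (by fun_prop)
    (fun x _ => by
      have := ((hasDerivAt_id' x).sub_const a).const_mul (2 * (K.2 - K.1 - c))
      simpa using (this.const_sub (-(2 * ((w a).2 - (w a).1)))).hasDerivWithinAt)
    (fun x hx => by linarith [hc x hx]) (right_mem_Icc.2 hab)
  simp only [Pi.neg_apply] at this
  linarith

/-- Just to the right of a point where `pr₂ < pr₁ + (K₂ - K₁)`, the product increases. -/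
theorem eventually_prod_gt (h : IsBranch K w pl pr) {x : ℝ} (hx : 0 ≤ x)
    (hlt : (pr x).2 - (pr x).1 < K.2 - K.1) :
    ∀ᶠ z in 𝓝[>] x, 2 * ((w x).2 - (w x).1) < 2 * ((w z).2 - (w z).1) := by
  obtain ⟨c, hc1, hc2⟩ := exists_between hlt
  have ht : Tendsto (fun z => (pr z).2 - (pr z).1) (𝓝[>] x) (𝓝 ((pr x).2 - (pr x).1)) :=
    ((continuous_snd.sub continuous_fst).tendsto (pr x)).comp (h.right x hx)
  obtain ⟨d, hd, hsub⟩ := mem_nhdsGT_iff_exists_Ioo_subset.1 (ht.eventually_lt_const hc1)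
  filter_upwards [Ioo_mem_nhdsGT hd] with z hz
  have h1 := h.le_prod (c := c) hx hz.1.le (fun y hy => by
    rcases hy.1.lt_or_eq with h2 | h2
    · exact (hsub ⟨h2, hy.2.trans hz.2⟩ : _ < c).le
    · exact h2 ▸ hc1.le)
  have : 0 < 2 * (K.2 - K.1 - c) * (z - x) :=
    mul_pos (by linarith) (sub_pos.2 hz.1)
  linarith

theorem continuousOn (h : IsBranch K w pl pr) {a : ℝ} (ha : 0 ≤ a)
    (hnj : ∀ x > a, pl x = pr x) : ContinuousOn pr (Ici a) := by
  intro x hx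
  rcases (mem_Ici.1 hx).lt_or_eq with h1 | h1
  · refine ContinuousAt.continuousWithinAt ?_
    rw [continuousAt_iff_continuous_left'_right']
    have h2 := h.left x (ha.trans_lt h1)
    rw [hnj x h1] at h2
    exact ⟨h2, h.right x (ha.trans h1.le)⟩
  · subst h1
    rw [← continuousWithinAt_Ioi_iff_Ici]
    exact h.right a ha

theorem hasDerivAt (h : IsBranch K w pl pr) {a : ℝ} (ha : 0 ≤ a)
    (hnj : ∀ x > a, pl x = pr x) {x : ℝ} (hx : a < x) (hne : pr x ≠ 0) :
    HasDerivAt pr ((disc (pr x))⁻¹ • field K (pr x)) x := by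
  have hx0 := ha.trans_lt hx
  refine hasDerivAt_of_hamil (w := w)
    ((h.continuousOn ha hnj).continuousAt (Ici_mem_nhds hx)) ?_ ?_ hne
  · have h1 := h.derivLeft x hx0
    rw [hnj x hx] at h1
    have := h1.union (h.derivRight x hx0.le)
    rwa [Iic_union_Ici, hasDerivWithinAt_univ] at this
  · filter_upwards [Ioi_mem_nhds hx0] with z hz using h.value z (le_of_lt hz)

/-- No branch without jumps and zeros starts in the region where the product is nonnegative. -/
theorem false_of_no_jump (hK : IsUnstableFocus K) (h : IsBranch K w pl pr) {a : ℝ} (ha : 0 ≤ a)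
    (hnj : ∀ x > a, pl x = pr x) (hne : ∀ x ≥ a, pr x ≠ 0)
    (hy : 0 ≤ 2 * ((w a).2 - (w a).1)) : False := by
  obtain ⟨C, hC⟩ := h.growth
  rcases hK.tendsto_zero_or_eq_of_disc (C := 4 * C) ha (h.continuousOn ha hnj) hne
    (fun x hx => h.hasDerivAt ha hnj hx (hne x (le_of_lt hx)))
    (fun x hx => by
      have h1 := disc_le_norm_hamil (pr x)
      rw [h.value x (ha.trans hx)] at h1
      linarith [hC x (ha.trans hx)]) with h1 | h1
  · have hδ := hK.sub_pos
    have h2 : Tendsto (fun z => (pr z).2 - (pr z).1) atTop (𝓝 0) := by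
      have := ((continuous_snd.sub continuous_fst).tendsto (0 : ℝ × ℝ)).comp h1
      simpa [Function.comp_def] using this
    have h3 : Tendsto (fun z => 2 * ((w z).2 - (w z).1)) atTop (𝓝 0) := by
      have h2' : Tendsto (fun z => (pr z).1 + (pr z).2) atTop (𝓝 0) := by
        have := ((continuous_fst.add continuous_snd).tendsto (0 : ℝ × ℝ)).comp h1
        simpa [Function.comp_def] using this
      have := h2'.mul h2
      rw [mul_zero] at this
      refine this.congr' ?_
      filter_upwards [eventually_ge_atTop 0] with x hx
      rw [h.prod_eq hx]
    -- Past T the product lies in (-1/2, 1/2) yet grows at rate at least K₂ - K₁, hence by 1 over a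
    -- length 1/(K₂ - K₁).
    obtain ⟨T, hT⟩ := eventually_atTop.1 ((eventually_ge_atTop a).and
      ((h2.eventually_lt_const (half_pos hδ)).and
        ((h3.eventually_lt_const (show (0 : ℝ) < 1 / 2 by norm_num)).and
          (h3.eventually_const_lt (show (-(1 / 2) : ℝ) < 0 by norm_num)))))
    have hTa := (hT T le_rfl).1
    have hle : T ≤ T + 1 / (K.2 - K.1) := by
      have : 0 < 1 / (K.2 - K.1) := by positivity
      linarith
    have h4 := h.le_prod (c := (K.2 - K.1) / 2) (ha.trans hTa) hle
      (fun x hx => (hT x hx.1).2.1.le)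
    have h5 := (hT _ hle).2.2.1
    have h6 := (hT T le_rfl).2.2.2
    have h7 : 2 * (K.2 - K.1 - (K.2 - K.1) / 2) * (T + 1 / (K.2 - K.1) - T) = 1 := by
      field_simp; ring
    linarith
  -- At rest at K the product is (K₁ + K₂)(K₂ - K₁) < 0.
  · have h2 := eq_of_continuousWithinAt_of_forall_gt
      ((h.continuousOn ha hnj) a self_mem_Ici) h1 a le_rfl
    rw [h.prod_eq ha, h2] at hy
    have := mul_neg_of_neg_of_pos hK.add_neg hK.sub_pos
    linarith

/-- The open third quadrant of the coordinates `(p₁ + p₂, p₂ - p₁)` is left neither continuously nor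
by a jump. -/
theorem neg_neg_of_Ico (hK : IsUnstableFocus K) (h : IsBranch K w pl pr) {a T : ℝ} (ha : 0 ≤ a)
    (haT : a < T) (hneg : ∀ z ∈ Ico a T, (pr z).1 + (pr z).2 < 0 ∧ (pr z).2 - (pr z).1 < 0) :
    pl T = pr T ∧ (pr T).1 + (pr T).2 < 0 ∧ (pr T).2 - (pr T).1 < 0 := by
  have hT0 := ha.trans_lt haT
  have hδ := hK.sub_pos
  have h1 := h.le_prod (c := 0) ha haT.le (fun x hx => (hneg x hx).2.le)
  have h2 : 0 < 2 * ((w a).2 - (w a).1) := by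
    rw [h.prod_eq ha]
    exact mul_pos_of_neg_of_neg (hneg a ⟨le_rfl, haT⟩).1 (hneg a ⟨le_rfl, haT⟩).2
  have h3 : 0 < 2 * ((w T).2 - (w T).1) := by
    have : 0 < 2 * (K.2 - K.1 - 0) * (T - a) := mul_pos (by linarith) (by linarith)
    linarith
  rw [h.prod_eq_left hT0] at h3
  have hs : (pl T).1 + (pl T).2 ≤ 0 := by
    refine le_of_tendsto (((continuous_fst.add continuous_snd).tendsto (pl T)).comp
      (h.left T hT0)) ?_
    filter_upwards [Ico_mem_nhdsLT haT] with z hz using (hneg z hz).1.le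
  have he : (pl T).2 - (pl T).1 ≤ 0 := by
    refine le_of_tendsto (((continuous_snd.sub continuous_fst).tendsto (pl T)).comp
      (h.left T hT0)) ?_
    filter_upwards [Ico_mem_nhdsLT haT] with z hz using (hneg z hz).2.le
  have hs' : (pl T).1 + (pl T).2 < 0 := lt_of_le_of_ne hs (fun e => by rw [e] at h3; simp at h3)
  have he' : (pl T).2 - (pl T).1 < 0 := lt_of_le_of_ne he (fun e => by rw [e] at h3; simp at h3)
  rcases h.eq_or_eq_neg hT0 with h4 | ⟨-, h4⟩
  · rw [← h4]
    exact ⟨rfl, hs', he'⟩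
  · linarith

theorem false_of_neg_neg (hK : IsUnstableFocus K) (h : IsBranch K w pl pr) {a : ℝ} (ha : 0 ≤ a)
    (hs : (pr a).1 + (pr a).2 < 0) (he : (pr a).2 - (pr a).1 < 0) : False := by
  have hall : ∀ x ≥ a, (pr x).1 + (pr x).2 < 0 ∧ (pr x).2 - (pr x).1 < 0 := by
    refine forall_ge_of_induction ⟨hs, he⟩ (fun x hx hP => ?_) fun x hx hP =>
      (h.neg_neg_of_Ico hK ha hx hP).2
    have h1 := h.right x (ha.trans hx)
    filter_upwards [(((continuous_fst.add continuous_snd).tendsto (pr x)).comp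
      h1).eventually_lt_const hP.1, (((continuous_snd.sub continuous_fst).tendsto (pr x)).comp
      h1).eventually_lt_const hP.2] with z hz1 hz2 using ⟨hz1, hz2⟩
  refine h.false_of_no_jump hK ha (fun x hx => (h.neg_neg_of_Ico hK ha hx fun z hz =>
    hall z hz.1).1) (fun x hx h0 => ?_) ?_
  · have := (hall x hx).1
    rw [h0] at this
    simp at this
  · rw [h.prod_eq ha]
    exact (mul_pos_of_neg_of_neg hs he).le

/-- The product starts nonnegative and increases, so just to the right it is positive. A coordinate
that is strictly negative stays so, and the other must join it in the forbidden quadrant. -/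
theorem eq_zero_of_nonpos_nonpos (hK : IsUnstableFocus K) (h : IsBranch K w pl pr) {a : ℝ}
    (ha : 0 ≤ a) (hs : (pr a).1 + (pr a).2 ≤ 0) (he : (pr a).2 - (pr a).1 ≤ 0) : pr a = 0 := by
  by_contra hne
  have h0 : 0 ≤ 2 * ((w a).2 - (w a).1) := by
    rw [h.prod_eq ha]
    exact mul_nonneg_of_nonpos_of_nonpos hs he
  have h1 := h.eventually_prod_gt ha (by linarith [hK.sub_pos])
  have h2 := h.right a ha
  have hnn : (pr a).1 + (pr a).2 < 0 ∨ (pr a).2 - (pr a).1 < 0 := by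
    by_contra! hcon
    apply hne
    ext <;> simp only [Prod.fst_zero, Prod.snd_zero] <;> linarith
  rcases hnn with h3 | h3
  · obtain ⟨z, hz1, hz2, hz⟩ := (h1.and (((((continuous_fst.add continuous_snd).tendsto
      (pr a)).comp h2).eventually_lt_const h3).and self_mem_nhdsWithin)).exists
    have hz0 : 0 ≤ z := ha.trans (le_of_lt hz)
    simp only [Function.comp_apply] at hz2
    have hp : 0 < ((pr z).1 + (pr z).2) * ((pr z).2 - (pr z).1) := by
      rw [← h.prod_eq hz0]; linarith
    exact h.false_of_neg_neg hK hz0 hz2 (neg_of_mul_pos_right hp hz2.le)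
  · obtain ⟨z, hz1, hz2, hz⟩ := (h1.and (((((continuous_snd.sub continuous_fst).tendsto
      (pr a)).comp h2).eventually_lt_const h3).and self_mem_nhdsWithin)).exists
    have hz0 : 0 ≤ z := ha.trans (le_of_lt hz)
    simp only [Function.comp_apply] at hz2
    have hp : 0 < ((pr z).1 + (pr z).2) * ((pr z).2 - (pr z).1) := by
      rw [← h.prod_eq hz0]; linarith
    exact h.false_of_neg_neg hK hz0 (neg_of_mul_pos_left hp hz2.le) hz2

/-- A branch on which the product starts nonnegative stays in the closed upper half plane and has no
jumps. -/
theorem nonneg_and_no_jump (hK : IsUnstableFocus K) (h : IsBranch K w pl pr)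
    (hy : 0 ≤ 2 * ((w 0).2 - (w 0).1)) :
    (∀ x ≥ 0, 0 ≤ (pr x).2 - (pr x).1) ∧ ∀ x > 0, pl x = pr x := by
  have dead := fun {x : ℝ} (hx : 0 ≤ x) => h.eq_zero_of_nonpos_nonpos hK hx
  have hleft : ∀ T > 0, (∀ z ∈ Ico 0 T, 0 ≤ (pr z).2 - (pr z).1) →
      pl T = pr T ∧ 0 ≤ (pr T).2 - (pr T).1 := by
    intro T hT hP
    have he : 0 ≤ (pl T).2 - (pl T).1 := by
      refine ge_of_tendsto (((continuous_snd.sub continuous_fst).tendsto (pl T)).comp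
        (h.left T hT)) ?_
      filter_upwards [Ico_mem_nhdsLT hT] with z hz using hP z hz
    rcases h.eq_or_eq_neg hT with h1 | ⟨h1, h2⟩
    · exact ⟨h1, h1 ▸ he⟩
    -- A jump from the closed first quadrant lands in the closed third one, hence at 0, and is no
    -- jump at all.
    · have h3 : pr T = 0 := dead hT.le (by rw [h1]; simp only [Prod.fst_neg, Prod.snd_neg]; linarith)
        (by rw [h1]; simp only [Prod.fst_neg, Prod.snd_neg]; linarith)
      rw [h3, eq_comm, neg_eq_zero] at h1
      rw [h1, h3]
      simp
  -- Nonnegativity of p₂ - p₁ alone is not inductive: on p₂ = p₁ the sign of p₁ + p₂ must be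
  -- recorded.
  have hmain : ∀ x ≥ 0, 0 < (pr x).2 - (pr x).1 ∨
      ((pr x).2 - (pr x).1 = 0 ∧ 0 ≤ (pr x).1 + (pr x).2) := by
    refine forall_ge_of_induction ?_ (fun x hx hP => ?_) fun x hx hP => ?_
    · by_contra! hcon
      obtain ⟨h1, h2⟩ := hcon
      have h3 : (pr 0).1 + (pr 0).2 ≤ 0 := by
        rcases h1.lt_or_eq with h4 | h4
        · rw [h.prod_eq le_rfl] at hy
          exact nonpos_of_mul_nonneg_left hy h4
        · exact (h2 h4).le
      have h4 := dead le_rfl h3 h1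
      rw [h4] at h2
      simp at h2
    · have ht : Tendsto (fun z => (pr z).2 - (pr z).1) (𝓝[>] x) (𝓝 ((pr x).2 - (pr x).1)) :=
        ((continuous_snd.sub continuous_fst).tendsto (pr x)).comp (h.right x hx)
      rcases hP with hP | ⟨hP, -⟩
      · filter_upwards [ht.eventually_const_lt hP] with z hz using Or.inl hz
      · have h1 := h.eventually_prod_gt hx (by rw [hP]; exact hK.sub_pos)
        rw [h.prod_eq hx, hP, mul_zero] at h1
        filter_upwards [h1, self_mem_nhdsWithin] with z hz hzx
        have hz0 : 0 ≤ z := hx.trans (le_of_lt hzx)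
        rw [h.prod_eq hz0] at hz
        rcases pos_and_pos_or_neg_and_neg_of_mul_pos hz with ⟨-, h2⟩ | ⟨h2, h3⟩
        · exact Or.inl h2
        · exact absurd (h.false_of_neg_neg hK hz0 h2 h3) id
    · have h1 := (hleft x hx fun z hz => (hP z hz).elim le_of_lt fun h2 => h2.1.ge).2
      rcases h1.lt_or_eq with h2 | h2
      · exact Or.inl h2
      · refine Or.inr ⟨h2.symm, ?_⟩
        by_contra! h3
        have h4 := dead hx.le h3.le h2.symm.le
        rw [h4] at h3
        simp at h3
  have hnn : ∀ x ≥ 0, 0 ≤ (pr x).2 - (pr x).1 := fun x hx =>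
    (hmain x hx).elim le_of_lt fun h2 => h2.1.ge
  exact ⟨hnn, fun x hx => (hleft x hx fun z hz => hnn z hz.1).1⟩

end IsBranch

/-- There is no loop at the origin in the upper half plane, since the Lyapunov function increases. -/
theorem false_of_planar_loop {m a b T : ℝ} {S E c : ℝ → ℝ} (hm0 : 0 < m) (hab : a < b)
    (hbT : b < T) (hSc : ContinuousOn S (Icc a T)) (hEc : ContinuousOn E (Icc a T))
    (hcpos : ∀ x ∈ Ioo a T, 0 < c x)
    (dS : ∀ x ∈ Ioo a T, HasDerivAt S (c x * (-m * S x + E x - S x ^ 2 - E x ^ 2)) x)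
    (dE : ∀ x ∈ Ioo a T, HasDerivAt E (c x * (3 * S x + m * E x - 2 * S x * E x)) x)
    (hE0 : ∀ x ∈ Icc a T, 0 ≤ E x) (hSa : S a = 0) (hEa : E a = 0) (hST : S T = 0) (hET : E T = 0)
    (hSb : 0 < S b) (hEb : 0 < E b) : False := by
  have hlt : ∀ x ∈ Icc a T, E x < 3 / 2 := by
    intro x hx
    by_contra! hge
    rcases hx.1.lt_or_eq with h1 | h1
    · have := ge_of_deriv_pos_of_eq (hEc.mono (Icc_subset_Icc_left hx.1))
        (fun y hy => (dE y ⟨h1.trans_le hy.1, hy.2⟩).hasDerivWithinAt) hge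
        (fun y hy he => by
          rw [he]
          exact mul_pos (hcpos y ⟨h1.trans_le hy.1, hy.2⟩) (by linarith)) T ⟨hx.2, le_rfl⟩
      linarith
    · rw [← h1, hEa] at hge
      norm_num at hge
  have hVc : ContinuousOn (fun x => lyap m (S x) (E x)) (Icc a T) :=
    (continuousOn_lyap m).comp (hSc.prodMk hEc) hlt
  have dV := fun x (hx : x ∈ Ioo a T) =>
    hasDerivAt_lyap (dS x hx) (dE x hx) (hlt x (Ioo_subset_Icc_self hx))
  have hmono : MonotoneOn (fun x => lyap m (S x) (E x)) (Icc a T) := by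
    refine monotoneOn_of_deriv_nonneg (convex_Icc a T) hVc ?_ ?_ <;> rw [interior_Icc]
    · exact fun x hx => (dV x hx).differentiableAt.differentiableWithinAt
    · intro x hx
      rw [(dV x hx).deriv]
      have h1 := (hcpos x hx).le
      have h2 := hE0 x (Ioo_subset_Icc_self hx)
      positivity
  have haT : a ≤ T := (hab.trans hbT).le
  have hends : lyap m (S a) (E a) = lyap m (S T) (E T) := by rw [hEa, hSa, hET, hST]
  -- Equal end values make the monotone `lyap` constant on the loop, but its derivative at b is
  -- positive, as S and E are positive there.
  have hzero : HasDerivAt (fun x => lyap m (S x) (E x)) 0 b := by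
    refine (hasDerivAt_const b (lyap m (S a) (E a))).congr_of_eventuallyEq ?_
    filter_upwards [Icc_mem_nhds hab hbT] with x hx
    exact le_antisymm (hends ▸ hmono hx (right_mem_Icc.2 haT) hx.2)
      (hmono (left_mem_Icc.2 haT) hx hx.1)
  have hb : b ∈ Ioo a T := ⟨hab, hbT⟩
  have heq := (dV b hb).unique hzero
  have hr : 0 < 3 - 2 * E b := by linarith [hlt b (Ioo_subset_Icc_self hb)]
  have hcb := hcpos b hb
  exact absurd heq (by positivity)

namespace IsBranch

variable {K : ℝ × ℝ} {w pl pr : ℝ → ℝ × ℝ}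

/-- A branch without jumps in the closed upper half plane which leaves the origin cannot return to
it. -/
theorem ne_zero_of_zero (hK : IsUnstableFocus K) (h : IsBranch K w pl pr)
    (hnn : ∀ x ≥ 0, 0 ≤ (pr x).2 - (pr x).1) (hnj : ∀ x > 0, pl x = pr x) {a b T : ℝ}
    (ha : 0 ≤ a) (hab : a < b) (hbT : b < T) (h0 : pr a = 0)
    (hy : ∀ x ∈ Ioc a b, 0 < 2 * ((w x).2 - (w x).1)) (hne : ∀ x ∈ Ico b T, pr x ≠ 0) :
    pr T ≠ 0 := by
  intro hT
  have hδ := hK.sub_pos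
  have hpr : ContinuousOn pr (Icc a T) :=
    (h.continuousOn le_rfl hnj).mono (Icc_subset_Ici_self.trans (Ici_subset_Ici.2 ha))
  have hne' : ∀ x ∈ Ioo a T, pr x ≠ 0 := by
    intro x hx h1
    rcases le_or_gt x b with hxb | hxb
    · have := hy x ⟨hx.1, hxb⟩
      rw [h.prod_eq (ha.trans hx.1.le), h1] at this
      simp at this
    · exact hne x ⟨hxb.le, hx.2⟩ h1
  have hder : ∀ x ∈ Ioo a T, HasDerivAt pr ((disc (pr x))⁻¹ • field K (pr x)) x := fun x hx =>
    h.hasDerivAt le_rfl hnj (ha.trans_lt hx.1) (hne' x hx)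
  have hyb := hy b ⟨hab, le_rfl⟩
  rw [h.prod_eq (ha.trans hab.le)] at hyb
  have he : 0 < (pr b).2 - (pr b).1 :=
    lt_of_le_of_ne (hnn b (ha.trans hab.le)) (fun e => by rw [← e] at hyb; simp at hyb)
  have hs : 0 < (pr b).1 + (pr b).2 := pos_of_mul_pos_left hyb he.le
  refine false_of_planar_loop (S := fun x => ((pr x).1 + (pr x).2) / (K.2 - K.1))
    (E := fun x => ((pr x).2 - (pr x).1) / (K.2 - K.1)) hK.param_pos hab hbT (by fun_prop)
    (by fun_prop) (fun x hx => ?_) (fun x hx => hK.hasDerivAt_sum (hder x hx))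
    (fun x hx => hK.hasDerivAt_diff (hder x hx))
    (fun x hx => div_nonneg (hnn x (ha.trans hx.1)) hδ.le) (by simp [h0]) (by simp [h0])
    (by simp [hT]) (by simp [hT]) (div_pos hs hδ) (div_pos he hδ)
  have := inv_pos.2 (disc_pos (hne' x hx))
  positivity

/-- On a branch the product of the coordinates is negative at the origin of the half-line. -/
theorem prod_neg (hK : IsUnstableFocus K) (h : IsBranch K w pl pr) :
    2 * ((w 0).2 - (w 0).1) < 0 := by
  by_contra! hy
  obtain ⟨hnn, hnj⟩ := h.nonneg_and_no_jump hK hy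
  by_cases hz : ∀ x ≥ 0, pr x ≠ 0
  · exact h.false_of_no_jump hK le_rfl hnj hz hy
  push Not at hz
  obtain ⟨a, ha, h0⟩ := hz
  -- A branch leaves the origin with positive product. A first return would close a loop, so beyond
  -- this zero the case without zeros applies.
  have h1 := h.eventually_prod_gt ha (by rw [h0]; simpa using hK.sub_pos)
  rw [h.prod_eq ha, h0] at h1
  simp only [Prod.fst_zero, Prod.snd_zero, sub_zero, mul_zero] at h1
  obtain ⟨d, hd, hsub⟩ := mem_nhdsGT_iff_exists_Ioo_subset.1 h1
  have hret : ∀ x > a, pr x ≠ 0 := by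
    intro x hx hx0
    obtain ⟨b, hab, hb⟩ := exists_between (lt_min hd hx)
    have hbd := hb.trans_le (min_le_left _ _)
    have hbx := hb.trans_le (min_le_right _ _)
    have hyb : ∀ z ∈ Ioc a b, 0 < 2 * ((w z).2 - (w z).1) := fun z hz =>
      hsub ⟨hz.1, hz.2.trans_lt hbd⟩
    have hcont : ContinuousOn pr (Icc b x) :=
      (h.continuousOn le_rfl hnj).mono (Icc_subset_Ici_self.trans
        (Ici_subset_Ici.2 (ha.trans hab.le)))
    have hclosed : IsClosed (Icc b x ∩ pr ⁻¹' {0}) :=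
      hcont.preimage_isClosed_of_isClosed isClosed_Icc isClosed_singleton
    have hbdd : BddBelow (Icc b x ∩ pr ⁻¹' {0}) := ⟨b, fun z hz => hz.1.1⟩
    have hmem := hclosed.csInf_mem ⟨x, ⟨hbx.le, le_rfl⟩, hx0⟩ hbdd
    set T := sInf (Icc b x ∩ pr ⁻¹' {0}) with hT
    have hTne : b ≠ T := by
      intro he
      have h2 := hyb b ⟨hab, le_rfl⟩
      have h3 : pr T = 0 := hmem.2
      rw [h.prod_eq (ha.trans hab.le), he, h3] at h2
      simp at h2
    refine h.ne_zero_of_zero hK hnn hnj ha hab (lt_of_le_of_ne hmem.1.1 hTne) h0 hyb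
      (fun z hz hz0 => ?_) hmem.2
    exact absurd (csInf_le hbdd ⟨⟨hz.1, hz.2.le.trans hmem.1.2⟩, hz0⟩) (not_le.2 hz.2)
  obtain ⟨b, hab, hbd⟩ := exists_between (show a < d from hd)
  exact h.false_of_no_jump hK (ha.trans hab.le) (fun x hx => hnj x (ha.trans_lt (hab.trans hx)))
    (fun x hx => hret x (hab.trans_le hx)) (le_of_lt (hsub ⟨hab, hbd⟩))

end IsBranch

/-! ### Branches of an admissible solution -/

namespace IsOneJumpCost

variable {h : ℝ → ℝ × ℝ} {K₀ K₁ : ℝ × ℝ}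

theorem hasDerivWithinAt_right (hh : IsOneJumpCost h K₀ K₁) {x : ℝ} (hx : 0 ≤ x) :
    HasDerivWithinAt h K₁ (Ici x) x := by
  rcases hx.lt_or_eq with hx | rfl
  · exact (hh.right x hx).hasDerivWithinAt
  · refine hasDerivWithinAt_Ici_of_tendsto_deriv (s := Ioi 0)
      (fun x hx => (hh.right x hx).differentiableAt.differentiableWithinAt)
      hh.continuous.continuousWithinAt self_mem_nhdsWithin (tendsto_const_nhds.congr' ?_)
    filter_upwards [self_mem_nhdsWithin] with x hx using (hh.right x hx).deriv.symm

theorem hasDerivWithinAt_left (hh : IsOneJumpCost h K₀ K₁) {x : ℝ} (hx : x ≤ 0) :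
    HasDerivWithinAt h K₀ (Iic x) x := by
  rcases hx.lt_or_eq with hx | rfl
  · exact (hh.left x hx).hasDerivWithinAt
  · refine hasDerivWithinAt_Iic_of_tendsto_deriv (s := Iio 0)
      (fun x hx => (hh.left x hx).differentiableAt.differentiableWithinAt)
      hh.continuous.continuousWithinAt self_mem_nhdsWithin (tendsto_const_nhds.congr' ?_)
    filter_upwards [self_mem_nhdsWithin] with x hx using (hh.left x hx).deriv.symm

theorem exists_growth (hh : IsOneJumpCost h K₀ K₁) : ∃ C : ℝ, ∀ x, ‖h x‖ ≤ C * (1 + |x|) := by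
  have hpos : ∀ x ≥ 0, ‖h x - h 0‖ ≤ ‖K₁‖ * x := fun x hx => by
    have := norm_image_sub_le_of_norm_deriv_right_le_segment (a := 0) (b := x)
      hh.continuous.continuousOn (fun y hy => hh.hasDerivWithinAt_right hy.1)
      (fun _ _ => le_rfl) x ⟨hx, le_rfl⟩
    simpa using this
  have hneg : ∀ x ≥ 0, ‖h (-x) - h 0‖ ≤ ‖K₀‖ * x := fun x hx => by
    have := norm_image_sub_le_of_norm_deriv_right_le_segment (f := fun x => h (-x)) (a := 0) (b := x)
      (f' := fun _ => (-1 : ℝ) • K₀) (C := ‖K₀‖) (by have := hh.continuous; fun_prop)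
      (fun y hy => by
        refine (hh.hasDerivWithinAt_left (x := -y) (by linarith [hy.1])).scomp y
          (hasDerivAt_neg y).hasDerivWithinAt fun z hz => ?_
        simpa using hz)
      (fun _ _ => by simp) x ⟨hx, le_rfl⟩
    simpa using this
  refine ⟨‖h 0‖ + ‖K₀‖ + ‖K₁‖, fun x => ?_⟩
  have h1 : ‖h x‖ ≤ ‖h x - h 0‖ + ‖h 0‖ := by
    have := norm_add_le (h x - h 0) (h 0)
    simpa using this
  have e0 := norm_nonneg K₀
  have e1 := norm_nonneg K₁
  have e2 := norm_nonneg (h 0)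
  rcases le_total 0 x with hx | hx
  · have := hpos x hx
    rw [abs_of_nonneg hx]
    nlinarith
  · have := hneg (-x) (by linarith)
    rw [neg_neg] at this
    rw [abs_of_nonpos hx]
    nlinarith

/-- A cost with gradients in the sectors three and four admits no admissible solution. -/
theorem not_isAdmissible (hh : IsOneJumpCost h K₀ K₁) (hK₀ : IsUnstableFocus (reflect K₀))
    (hK₁ : IsUnstableFocus K₁) (u : ℝ → ℝ × ℝ) : ¬ IsAdmissible h u := by
  intro hu
  obtain ⟨pl, pr, dR, dL, rR, lR, rL, lL, vR, vL, hj⟩ := hu.exists_oneSided hh.continuous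
  have hcont : Continuous u := continuous_iff_continuousAt.2 fun x =>
    continuousAt_iff_continuous_left_right.2 ⟨(dL x).continuousWithinAt, (dR x).continuousWithinAt⟩
  obtain ⟨C, hC⟩ : ∃ C : ℝ, ∀ x, ‖h x - u x‖ ≤ C * (1 + |x|) := by
    obtain ⟨C₁, hC₁⟩ := hh.exists_growth
    obtain ⟨C₂, hC₂⟩ := hu.growth
    exact ⟨C₁ + C₂, fun x => (norm_sub_le _ _).trans (by linarith [hC₁ x, hC₂ x])⟩
  have hfwd : IsBranch K₁ (fun x => h x - u x) pl pr :=
    { cont := (hh.continuous.sub hcont).continuousOn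
      derivRight := fun x hx => (hh.hasDerivWithinAt_right hx).fun_sub (dR x)
      derivLeft := fun x hx => (hh.right x hx).hasDerivWithinAt.fun_sub (dL x)
      right := fun x _ => rR x
      left := fun x _ => rL x
      value := fun x _ => vR x
      valueLeft := fun x _ => vL x
      jump := fun x _ hne => (hj x hne).2
      growth := ⟨C, fun x hx => by simpa [abs_of_nonneg hx] using hC x⟩ }
  have hswap : ∀ {f : ℝ → ℝ × ℝ} {f' : ℝ × ℝ} {x : ℝ} {s t : Set ℝ},
      HasDerivWithinAt f (K₀ - f') s (-x) → MapsTo Neg.neg t s →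
      HasDerivWithinAt (fun x => (f (-x)).swap) (reflect K₀ - reflect f') t x := by
    intro f f' x s t hf hst
    have h1 := hf.scomp x (hasDerivAt_neg x).hasDerivWithinAt hst
    have h2 : HasDerivWithinAt (fun x => (f (-x)).1) ((-1 : ℝ) • (K₀ - f')).1 t x :=
      (ContinuousLinearMap.fst ℝ ℝ ℝ).hasFDerivAt.comp_hasDerivWithinAt x h1
    have h3 : HasDerivWithinAt (fun x => (f (-x)).2) ((-1 : ℝ) • (K₀ - f')).2 t x :=
      (ContinuousLinearMap.snd ℝ ℝ ℝ).hasFDerivAt.comp_hasDerivWithinAt x h1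
    refine (h3.prodMk h2).congr_deriv ?_
    ext <;> simp [reflect] <;> ring
  have hR : ∀ x : ℝ, Tendsto Neg.neg (𝓝[>] x) (𝓝[<] (-x)) := fun x => tendsto_neg_nhdsGT
  have hL : ∀ x : ℝ, Tendsto Neg.neg (𝓝[<] x) (𝓝[>] (-x)) := fun x => tendsto_neg_nhdsLT
  -- Reversing x exchanges the left and right limits, and reflecting the gradient swaps the
  -- components of w, so the product changes sign.
  have hbwd : IsBranch (reflect K₀) (fun x => (h (-x) - u (-x)).swap) (fun x => reflect (pr (-x)))
      (fun x => reflect (pl (-x))) :=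
    { cont := by
        exact (continuous_swap.comp ((hh.continuous.comp continuous_neg).sub
          (hcont.comp continuous_neg))).continuousOn
      derivRight := fun x hx => hswap (f := fun x => h x - u x) (s := Iic (-x))
        ((hh.hasDerivWithinAt_left (by linarith)).fun_sub (dL (-x)))
        (fun z hz => neg_le_neg (mem_Ici.1 hz))
      derivLeft := fun x hx => hswap (f := fun x => h x - u x) (s := Ici (-x))
        ((hh.left (-x) (by linarith)).hasDerivWithinAt.fun_sub (dR (-x)))
        (fun z hz => neg_le_neg (mem_Iic.1 hz))
      right := fun x _ => (continuous_reflect.tendsto _).comp ((lL (-x)).comp (hR x))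
      left := fun x _ => (continuous_reflect.tendsto _).comp ((lR (-x)).comp (hL x))
      value := fun x _ => by rw [hamil_reflect, vL]
      valueLeft := fun x _ => by rw [hamil_reflect, vR]
      jump := fun x _ hne => by
        have := (hj (-x) fun e => hne (by rw [e])).1
        simp only [reflect]
        linarith
      growth := ⟨C, fun x hx => by
        have := hC (-x)
        rw [abs_neg, abs_of_nonneg hx] at this
        rw [Prod.norm_def] at this ⊢
        simpa [max_comm] using this⟩ }
  have h1 := hfwd.prod_neg hK₁
  have h2 := hbwd.prod_neg hK₀
  simp only [neg_zero, Prod.fst_swap, Prod.snd_swap] at h1 h2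
  linarith

end IsOneJumpCost

end DiffGame

end

theorem mainTheorem4 (K₀ K₁ : ℝ × ℝ) (hK₀ : K₀ ∈ DiffGame.sector 3) (hK₁ : K₁ ∈ DiffGame.sector 4)
    (h : ℝ → ℝ × ℝ) (hh : DiffGame.IsOneJumpCost h K₀ K₁) :
    (¬ ∃ u : ℝ → ℝ × ℝ, DiffGame.IsAdmissible h u) ∧
    ∀ (I : Set ℝ) (p : ℝ → ℝ × ℝ), DiffGame.IsMaximalRescaledSolution K₀ K₁ I p → Ici 0 ⊆ I →
      (∃ C : ℝ, ∀ᶠ s in atTop, ‖p s‖ ≤ C) →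
      (Tendsto p atTop (𝓝 0) ∨ ∀ s, 0 ≤ s → p s = K₁) ∧
      ((∃ σ < 0, I = Ioi σ ∧ Tendsto (fun s => ‖p s‖) (𝓝[>] σ) atTop) ∨
        (I = univ ∧ (Tendsto p atBot (𝓝 0) ∨ ∀ s, s ≤ 0 → p s = K₀))) := by
  have hK₀' := DiffGame.isUnstableFocus_reflect_of_mem_sector hK₀
  have hK₁' := DiffGame.isUnstableFocus_of_mem_sector hK₁
  exact ⟨fun ⟨u, hu⟩ => hh.not_isAdmissible hK₀' hK₁' u hu,
    fun _ _ hp hI _ => hp.dichotomy hK₀' hK₁' hI⟩
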